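/- Let $k\ge 1$, $\gamma\in\mathbb R\setminus\{0,-1,-2,\dots\}$, let $\lambda_1,\dots,\lambda_k$ be distinct non-zero real numbers, and let $(\gamma)_0=1$, $(\gamma)_l=\gamma(\gamma+1)\cdots(\gamma+l-1)$. Let $T_l$ be the Chebyshev polynomials, and put, for $x\in[-1,1]$, $$F_j(x)=\sum_{l\ge 0}\frac{\lambda_j^l}{(\gamma)_l}T_l(x),\qquad E_j(z)=\sum_{l\ge 0}\frac{(\lambda_j z)^l}{(\gamma)_l}\qquad(j=1,\dots,k).$$ For $n\in\mathbb Z_{\ge0}$ and $\vec m=(m_1,\dots,m_k)\in\mathbb Z_{\ge0}^k$ put $m=m_1+\dots+m_k$, $n_j=n+m-m_j$ and $U_\gamma(t)=t^{n+\gamma-1}\prod_{p=1}^k(t-\lambda_p)^{m_p}$. All polynomials below have complex coefficients, denominators $Q$ have degree at most $m$, numerators $P_j$ have degree at most $n_j$, and series in Chebyshev polynomials are to converge absolutely on $[-1,1]$. - Nonlinear Hermite–Chebyshev approximations of $(F_1,\dots,F_k)$ for $(n,\vec m)$ are fractions $\widehat P_j/\widehat Q$, with $\widehat Q$ without zeros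 on $[-1,1]$, such that for every $j$ one has on $[-1,1]$ $F_j-\widehat P_j/\widehat Q=\sum_{l>n+m}\widehat a^j_lT_l$ with some coefficients $\widehat a_l^j$. - Linear Hermite–Chebyshev approximations are fractions $P_j/Q$ with $Q\not\equiv0$ such that for every $j$ one has on $[-1,1]$ $QF_j-P_j=\sum_{l>n+m}\tilde a^j_lT_l$ with some coefficients $\tilde a_l^j$. - $(Q,P_1,\dots,P_k)$ with $Q\not\equiv0$ are Hermite–Padé polynomials of $(E_1,\dots,E_k)$ for $(n,\vec m)$ if $Q(z)E_j(z)-P_j(z)=O(z^{n+m+1})$ as $z\to 0$ for every $j$. Then there is an $n_0$ such that for all $n\ge n_0$ and all $\vec m\ne(0,\dots,0)$ with $m_j\le n$ $(j=1,\dots,k)$ the following hold. 1. The denominator of the Hermite–Padé polynomials of $(E_1,\dots,E_k)$ for $(n,\vec m)$ is unique up to a constant factor and can be normalized by $Q_m(0)=1$. The integral $\int_0^{+\infty}U_\gamma(t)e^{-zt}\,dt$ converges absolutely for $\operatorname{Re}z>0$ and continues analytically to $\mathbb C\setminus\{-iy:y\ge0\}$; let $\Phi(z)$ be its continuation. 2.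 Nonlinear Hermite–Chebyshev approximations of $(F_1,\dots,F_k)$ for $(n,\vec m)$ exist, and the denominator of any such approximations $\widehat P_1/\widehat Q,\dots,\widehat P_k/\widehat Q$ is, after multiplication by a suitable non-zero constant, given for $x\in[-1,1]$ by $$\widehat Q(x)=Q_m(e^{i\arccos x})\,\overline{Q_m(e^{i\arccos x})}=\frac1{\Gamma^2(n+m+\gamma)}\left|\Phi\bigl(x+i\sqrt{1-x^2}\bigr)\right|^2 ;$$ in particular, for $0<x\le1$, $$\widehat Q(x)=\frac1{\Gamma^2(n+m+\gamma)}\left|\int_0^{+\infty}U_\gamma(t)e^{-t(x+i\sqrt{1-x^2})}\,dt\right|^2 .$$ 3. If, in addition, $0<\lambda_1<\lambda_2<\dots<\lambda_k$, then for any nonlinear Hermite–Chebyshev approximations $\widehat P_1/\widehat Q,\dots,\widehat P_k/\widehat Q$ of $(F_1,\dots,F_k)$ for $(n,\vec m)$ there is a $j$ such that the rational function $\widehat P_j/\widehat Q$ is different from the $j$-th fraction $P_j/Q$ of every system of linear Hermite–Chebyshev approximations of $(F_1,\dots,F_k)$ for $(n,\vec m)$. -/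

import Mathlib

noncomputable section

/-- The Pochhammer symbol `(γ)_p = γ (γ + 1) ⋯ (γ + p - 1)`, with `(γ)_0 = 1`. -/
def poch (γ : ℝ) (p : ℕ) : ℝ := (ascPochhammer ℝ p).eval γ

/-- The power series `E_γ(lam z) = ∑ (lam z)^p / (γ)_p` of a Mittag-Leffler function. -/
def mittagLefflerSeries (γ lam : ℝ) : PowerSeries ℂ :=
  PowerSeries.mk fun p => ((lam ^ p / poch γ p : ℝ) : ℂ)

/-- The value at `x` of the Chebyshev polynomial `T_l`. -/
def chebT (l : ℕ) (x : ℝ) : ℝ := (Polynomial.Chebyshev.T ℝ (l : ℤ)).eval x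

/-- `F_γ(x; lam) = ∑ lam^l / (γ)_l T_l(x)`. -/
def chebF (γ lam x : ℝ) : ℝ := ∑' l : ℕ, lam ^ l / poch γ l * chebT l x

/-- `Q ≠ 0` and `P_1, …, P_k` are Hermite–Padé polynomials of the system `f` of power series for
the multi-index `(n, m)`: with `|m| = ∑ m_j` and `n_j = n + |m| - m_j` one has `deg Q ≤ |m|`,
`deg P_j ≤ n_j` and `Q f_j - P_j = O(z^{n + |m| + 1})`. -/
structure IsHermitePade {k : ℕ} (f : Fin k → PowerSeries ℂ) (n : ℕ) (m : Fin k → ℕ)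
    (Q : Polynomial ℂ) (P : Fin k → Polynomial ℂ) : Prop where
  ne_zero : Q ≠ 0
  natDegree_denom : Q.natDegree ≤ ∑ i, m i
  natDegree_num : ∀ j, (P j).natDegree ≤ n + ∑ i, m i - m j
  order : ∀ j, (PowerSeries.X : PowerSeries ℂ) ^ (n + ∑ i, m i + 1) ∣
    (Q : PowerSeries ℂ) * f j - (P j : PowerSeries ℂ)

/-- `g` is on `[-1, 1]` the sum of a series `∑_{l ≥ L} a_l T_l(x)` of Chebyshev polynomials with
complex coefficients. -/
def IsChebyshevTail (L : ℕ) (g : ℝ → ℂ) : Prop :=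
  ∃ a : ℕ → ℂ, (∀ l < L, a l = 0) ∧
    ∀ x ∈ Set.Icc (-1 : ℝ) 1, HasSum (fun l => a l * (chebT l x : ℂ)) (g x)

/-- `Q ≠ 0` and `P_1, …, P_k` are Hermite–Chebyshev polynomials of the system `f` for `(n, m)`:
`Q f_j - P_j = ∑_{l > n + |m|} a_l T_l`.  The fractions `P_j / Q` are then linear
Hermite–Chebyshev approximations. -/
structure IsLinearHermiteChebyshev {k : ℕ} (f : Fin k → ℝ → ℝ) (n : ℕ) (m : Fin k → ℕ)
    (Q : Polynomial ℂ) (P : Fin k → Polynomial ℂ) : Prop where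
  ne_zero : Q ≠ 0
  natDegree_denom : Q.natDegree ≤ ∑ i, m i
  natDegree_num : ∀ j, (P j).natDegree ≤ n + ∑ i, m i - m j
  remainder : ∀ j, IsChebyshevTail (n + ∑ i, m i + 1)
    fun x => Q.eval (x : ℂ) * (f j x : ℂ) - (P j).eval (x : ℂ)

/-- The fractions `P_j / Q` are nonlinear Hermite–Chebyshev approximations of the system `f` for
`(n, m)`: they are defined on `[-1, 1]` and `f_j - P_j / Q = ∑_{l > n + |m|} a_l T_l`. -/
structure IsNonlinearHermiteChebyshev {k : ℕ} (f : Fin k → ℝ → ℝ) (n : ℕ) (m : Fin k → ℕ)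
    (Q : Polynomial ℂ) (P : Fin k → Polynomial ℂ) : Prop where
  eval_ne_zero : ∀ x ∈ Set.Icc (-1 : ℝ) 1, Q.eval (x : ℂ) ≠ 0
  natDegree_denom : Q.natDegree ≤ ∑ i, m i
  natDegree_num : ∀ j, (P j).natDegree ≤ n + ∑ i, m i - m j
  remainder : ∀ j, IsChebyshevTail (n + ∑ i, m i + 1)
    fun x => (f j x : ℂ) - (P j).eval (x : ℂ) / Q.eval (x : ℂ)

/-- The rational function `P / Q`. -/
def ratQuot (P Q : Polynomial ℂ) : RatFunc ℂ :=
  algebraMap (Polynomial ℂ) (RatFunc ℂ) P / algebraMap (Polynomial ℂ) (RatFunc ℂ) Q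

/-- `U_γ(t) = t^{n + γ - 1} ∏_p (t - lam_p)^{m_p}` for `t > 0`. -/
def weightU {k : ℕ} (γ : ℝ) (lam : Fin k → ℝ) (n : ℕ) (m : Fin k → ℕ) (t : ℝ) : ℝ :=
  t ^ ((n : ℝ) + γ - 1) * ∏ p, (t - lam p) ^ m p

/-- `Φ` is the analytic continuation of the Laplace integral `∫_0^∞ U(t) e^{-zt} dt`, which has to
converge absolutely for `Re z > 0`, to the plane cut along `{-iy : y ≥ 0}`.  This domain is
connected and contains the closed upper half-plane without `0`. -/
def IsLaplaceContinuation (U : ℝ → ℝ) (Φ : ℂ → ℂ) : Prop :=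
  DifferentiableOn ℂ Φ {z : ℂ | z.re ≠ 0 ∨ 0 < z.im} ∧
  ∀ z : ℂ, 0 < z.re →
    MeasureTheory.IntegrableOn (fun t : ℝ => (U t : ℂ) * Complex.exp (-z * t)) (Set.Ioi 0) ∧
    Φ z = ∫ t in Set.Ioi (0 : ℝ), (U t : ℂ) * Complex.exp (-z * t)

end

noncomputable section

open Polynomial

/-! Write $d=\sum m_i$, $B(t)=\prod_p(t-\lambda_p)^{m_p}$ and $z=e^{i\theta}$, $x=\cos\theta$.

Hermite–Padé side. For $Q=\sum q_pz^p$ put $A(t)=\sum_r q_{d-r}t^r/(\gamma)_{n+r}$. Up to nonzero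
powers of $\lambda_j$, the coefficients of $z^{n+d-s}$, $s<m_j$, in $QE_j$ are the derivatives of
$t^{\gamma+n-1}A(t)$ at $\lambda_j$. The order conditions therefore say $B\mid A$, and since $\deg
A\le d=\deg B$, $A$ is a multiple of $B$ (`nodePoly_dvd_dualPoly_iff`). This gives uniqueness and
the explicit `padeDenom`. Termwise integration of $U_\gamma$ gives
$\Phi(z)=\Gamma(n+d+\gamma)\,z^{-(n+d+\gamma)}Q_m(z)$, and the power of $z$ has modulus one on the
circle.

Zeros. As $(\gamma)_{N-p}/(\gamma)_N\sim N^{-p}$, $Q_m(z)$ is close to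
$\prod_j(1-\lambda_jz/(n+d))^{m_j}$ uniformly in $\vec m$, and this product stays away from zero.
Hence $Q_m\ne0$ on the closed disc for large $n$ (`exists_forall_eval_padeDenom_ne_zero`).

Chebyshev side. $F_j(x)=(E_j(z)+E_j(1/z))/2$. If $R=E_j-P_j/Q_m$, then $(R(z)+R(1/z))/2$ is the
remainder of a fraction with denominator $Q_m(z)Q_m(1/z)$, which proves existence. Conversely any
$\widehat Q$ without zeros on $[-1,1]$ factors as $c\,q(z)q(1/z)$ with $q(0)=1$ and the zeros of $q$
outside the disc. Comparison of Fourier coefficients shows that $q$ is a Hermite–Padé denominator,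
so $q=Q_m$ (`IsNonlinearHermiteChebyshev.exists_invRootsPoly`).

Nonlinear versus linear. For the smallest $j$ with $m_j\ne0$ the first coefficient $\widehat
a^j_{n+d+1}$ is a nonzero multiple of $\int_0^1s^{\gamma+n-1}B(\lambda_js)\,ds$, whose integrand has
constant sign. Multiplying the remainder by a nonconstant $Q(x)$ moves this coefficient to an index
at most $n+d$, which a linear approximation forbids. -/

/-! ### Pochhammer symbols and convergence -/

theorem poch_zero (γ : ℝ) : poch γ 0 = 1 := by simp [poch]

theorem poch_succ (γ : ℝ) (p : ℕ) : poch γ (p + 1) = poch γ p * (γ + p) := by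
  simp [poch, ascPochhammer_succ_eval]

theorem poch_ne_zero {γ : ℝ} (hγ : ∀ p : ℕ, γ ≠ -(p : ℝ)) (p : ℕ) : poch γ p ≠ 0 := by
  induction p with
  | zero => simp [poch_zero]
  | succ p ih =>
    rw [poch_succ]
    exact mul_ne_zero ih fun h => hγ p (by linarith)

theorem summable_norm_pow_div_poch {γ : ℝ} (hγ : ∀ p : ℕ, γ ≠ -(p : ℝ)) (a : ℝ) :
    Summable fun l : ℕ => ‖a ^ l / poch γ l‖ := by
  by_cases ha : a = 0
  · subst ha
    refine summable_of_ne_finset_zero (s := {0}) fun l hl => ?_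
    have : l ≠ 0 := by simpa using hl
    simp [this]
  · have hne : ∀ l : ℕ, a ^ l / poch γ l ≠ 0 := fun l =>
      div_ne_zero (pow_ne_zero _ ha) (poch_ne_zero hγ l)
    refine (summable_of_ratio_test_tendsto_lt_one (l := 0) one_pos
      (Filter.Eventually.of_forall hne) ?_).norm
    have h1 : ∀ l : ℕ, ‖a ^ (l + 1) / poch γ (l + 1)‖ / ‖a ^ l / poch γ l‖ = |a| / |γ + l| := by
      intro l
      rw [← norm_div, poch_succ]
      have h2 := poch_ne_zero hγ l
      have h3 : γ + l ≠ 0 := fun h => hγ l (by linarith)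
      rw [show a ^ (l + 1) / (poch γ l * (γ + l)) / (a ^ l / poch γ l) = a / (γ + l) by
        field_simp
        ring]
      rw [Real.norm_eq_abs, abs_div]
    simp_rw [h1]
    refine Filter.Tendsto.div_atTop tendsto_const_nhds (Filter.tendsto_abs_atTop_atTop.comp ?_)
    exact Filter.tendsto_atTop_add_const_left _ _ tendsto_natCast_atTop_atTop

/-! ### Order of vanishing at a nonzero point through weighted coefficient sums -/

/-- The operator `a + X d/dX` on polynomials. -/
def eulerOp (a : ℂ) (A : ℂ[X]) : ℂ[X] := X * derivative A + C a * A

theorem coeff_eulerOp (a : ℂ) (A : ℂ[X]) (r : ℕ) :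
    (eulerOp a A).coeff r = (a + r) * A.coeff r := by
  cases r with
  | zero => simp [eulerOp]
  | succ r =>
    simp only [eulerOp, coeff_add, coeff_X_mul, coeff_derivative, coeff_C_mul]
    push_cast
    ring

/-- `eulerOp a` is $t^{-a}\circ t\,\frac{d}{dt}\circ t^a$, and $t^{\pm a}$ and $t$ are units near
$x\ne0$. So it lowers the order of a zero at $x$ by exactly one, whatever $a$ is. -/
theorem pow_dvd_iff_eulerOp {x : ℂ} (hx : x ≠ 0) (a : ℂ) (A : ℂ[X]) (M : ℕ) :
    (X - C x) ^ (M + 1) ∣ A ↔ A.eval x = 0 ∧ (X - C x) ^ M ∣ eulerOp a A := by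
  have key : ∀ (M : ℕ) (D : ℂ[X]), eulerOp a ((X - C x) ^ (M + 1) * D) =
      (X - C x) ^ M * (C ((M : ℂ) + 1) * X * D + (X - C x) * eulerOp a D) := by
    intro M D
    simp only [eulerOp, derivative_mul, derivative_X_sub_C_pow]
    simp only [Nat.cast_add, Nat.cast_one, Nat.add_sub_cancel, map_add, map_one, map_natCast]
    ring
  constructor
  · rintro ⟨D, rfl⟩
    refine ⟨by simp, ?_⟩
    rw [key]
    exact dvd_mul_right _ _
  · rintro ⟨h0, h1⟩
    induction M with
    | zero => simpa [dvd_iff_isRoot] using h0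
    | succ M ih =>
      obtain ⟨D, rfl⟩ := ih ((pow_dvd_pow _ (Nat.le_succ M)).trans h1)
      rw [key, pow_succ, mul_dvd_mul_iff_left (pow_ne_zero _ (X_sub_C_ne_zero x)),
        dvd_iff_isRoot] at h1
      have h2 : ((M : ℂ) + 1) * x * D.eval x = 0 := by simpa [IsRoot] using h1
      have h3 : D.eval x = 0 := by
        have : (M : ℂ) + 1 ≠ 0 := by exact_mod_cast Nat.succ_ne_zero M
        simpa [this, hx] using h2
      rw [pow_succ]
      exact mul_dvd_mul_left _ (dvd_iff_isRoot.2 h3)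

/-- The sums are the derivatives of $t^aA(t)$ at $x$ up to powers of $x$. Each differentiation
replaces $a$ by $a-1$, which is why the induction runs over all `a`. -/
theorem pow_dvd_iff_sum_descPochhammer {x : ℂ} (hx : x ≠ 0) (M d : ℕ) :
    ∀ (a : ℂ) (A : ℂ[X]), A.natDegree ≤ d → ((X - C x) ^ M ∣ A ↔ ∀ s < M,
      ∑ r ∈ Finset.range (d + 1),
        A.coeff r * x ^ r * (descPochhammer ℂ s).eval (a + r) = 0) := by
  induction M with
  | zero => simp
  | succ M ih =>
    intro a A hA
    have hE : (eulerOp a A).natDegree ≤ d := by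
      refine natDegree_le_iff_coeff_eq_zero.2 fun r hr => ?_
      rw [coeff_eulerOp, coeff_eq_zero_of_natDegree_lt (hA.trans_lt hr), mul_zero]
    rw [pow_dvd_iff_eulerOp hx a, ih (a - 1) _ hE, eval_eq_sum_range' (Nat.lt_succ_of_le hA)]
    have hs : ∀ s, (∑ r ∈ Finset.range (d + 1), (eulerOp a A).coeff r * x ^ r *
        (descPochhammer ℂ s).eval (a - 1 + r)) = ∑ r ∈ Finset.range (d + 1),
        A.coeff r * x ^ r * (descPochhammer ℂ (s + 1)).eval (a + r) := by
      intro s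
      refine Finset.sum_congr rfl fun r _ => ?_
      rw [coeff_eulerOp, descPochhammer_succ_left]
      simp only [eval_mul, eval_X, eval_comp, eval_sub, eval_one]
      rw [show a - 1 + r = a + r - 1 by ring]
      ring
    simp_rw [hs]
    constructor
    · rintro ⟨h0, h1⟩ s hs
      cases s with
      | zero => simpa using h0
      | succ s => exact h1 s (by omega)
    · intro h
      exact ⟨by simpa using h 0 (by omega), fun s hs => h (s + 1) (by omega)⟩

theorem poch_eq_mul_descPochhammer (γ : ℝ) (p s : ℕ) :
    poch γ (p + s) = poch γ p * (descPochhammer ℝ s).eval (γ + p + s - 1) := by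
  induction s generalizing p with
  | zero => simp
  | succ s ih =>
    rw [show p + (s + 1) = (p + 1) + s by ring, ih, poch_succ, descPochhammer_succ_right]
    simp only [eval_mul, eval_sub, eval_X, eval_natCast]
    push_cast
    ring_nf

/-! ### Explicit Hermite–Padé denominators and their uniqueness -/

/-- The polynomial `∏ (X - lam_p)^{m_p}`. -/
def nodePoly {k : ℕ} (lam : Fin k → ℝ) (m : Fin k → ℕ) : ℝ[X] := ∏ p, (X - C (lam p)) ^ m p

theorem monic_nodePoly {k : ℕ} (lam : Fin k → ℝ) (m : Fin k → ℕ) : (nodePoly lam m).Monic :=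
  monic_prod_of_monic _ _ fun _ _ => (monic_X_sub_C _).pow _

theorem natDegree_nodePoly {k : ℕ} (lam : Fin k → ℝ) (m : Fin k → ℕ) :
    (nodePoly lam m).natDegree = ∑ p, m p := by
  rw [nodePoly, natDegree_prod_of_monic _ _ fun _ _ => (monic_X_sub_C _).pow _]
  simp

/-- The explicit Hermite–Padé denominator of the Mittag-Leffler system. -/
def padeDenom {k : ℕ} (γ : ℝ) (lam : Fin k → ℝ) (n : ℕ) (m : Fin k → ℕ) : ℝ[X] :=
  ∑ p ∈ Finset.range (∑ i, m i + 1), C ((nodePoly lam m).coeff (∑ i, m i - p) *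
    (poch γ (n + (∑ i, m i - p)) / poch γ (n + ∑ i, m i))) * X ^ p

section

variable {k : ℕ} {γ : ℝ} {lam : Fin k → ℝ} {n : ℕ} {m : Fin k → ℕ}

theorem natDegree_padeDenom_le : (padeDenom γ lam n m).natDegree ≤ ∑ i, m i :=
  natDegree_sum_le_of_forall_le _ _ fun p hp =>
    (natDegree_C_mul_X_pow_le _ _).trans (by simpa [Nat.lt_succ_iff] using hp)

theorem coeff_padeDenom {p : ℕ} (hp : p ≤ ∑ i, m i) : (padeDenom γ lam n m).coeff p =
    (nodePoly lam m).coeff (∑ i, m i - p) *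
      (poch γ (n + (∑ i, m i - p)) / poch γ (n + ∑ i, m i)) := by
  simp only [padeDenom, finsetSum_coeff, coeff_C_mul, coeff_X_pow]
  simp [Nat.lt_succ_of_le hp]

theorem eval_zero_padeDenom (hγ : ∀ p : ℕ, γ ≠ -(p : ℝ)) : (padeDenom γ lam n m).eval 0 = 1 := by
  rw [← coeff_zero_eq_eval_zero, coeff_padeDenom (Nat.zero_le _), Nat.sub_zero,
    div_self (poch_ne_zero hγ _), mul_one, ← natDegree_nodePoly lam m]
  exact monic_nodePoly lam m

/-- The coefficient of `z^l`, `l ≥ deg Q`, in the product of a polynomial and a power series. -/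
theorem coeff_coe_mul_of_le {Q : ℂ[X]} {d l : ℕ} (hQ : Q.natDegree ≤ d) (hl : d ≤ l)
    (f : PowerSeries ℂ) : PowerSeries.coeff l ((Q : PowerSeries ℂ) * f) =
      ∑ r ∈ Finset.range (d + 1), Q.coeff (d - r) * PowerSeries.coeff (l - d + r) f := by
  rw [PowerSeries.coeff_mul, Finset.Nat.sum_antidiagonal_eq_sum_range_succ_mk,
    ← Finset.sum_subset (Finset.range_mono (Nat.succ_le_succ hl))]
  · rw [← Finset.sum_range_reflect]
    refine Finset.sum_congr rfl fun r hr => ?_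
    have hr' : r ≤ d := by simpa [Nat.lt_succ_iff] using hr
    rw [coeff_coe, show d + 1 - 1 - r = d - r by omega, show l - (d - r) = l - d + r by omega]
  · intro p _ hp
    have hp' : d < p := by simpa using hp
    rw [coeff_coe, coeff_eq_zero_of_natDegree_lt (hQ.trans_lt hp'), zero_mul]

/-- The polynomial `∑ q_{d-r} / (γ)_{n+r} X^r`; the order conditions of Hermite–Padé approximation
say that it is divisible by the node polynomial. -/
def dualPoly (γ : ℝ) (n d : ℕ) (Q : ℂ[X]) : ℂ[X] :=
  ∑ r ∈ Finset.range (d + 1), C (Q.coeff (d - r) / (poch γ (n + r) : ℂ)) * X ^ r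

theorem natDegree_dualPoly_le (γ : ℝ) (n d : ℕ) (Q : ℂ[X]) : (dualPoly γ n d Q).natDegree ≤ d :=
  natDegree_sum_le_of_forall_le _ _ fun p hp =>
    (natDegree_C_mul_X_pow_le _ _).trans (by simpa [Nat.lt_succ_iff] using hp)

theorem coeff_dualPoly {d r : ℕ} (hr : r ≤ d) (Q : ℂ[X]) :
    (dualPoly γ n d Q).coeff r = Q.coeff (d - r) / (poch γ (n + r) : ℂ) := by
  simp only [dualPoly, finsetSum_coeff, coeff_C_mul, coeff_X_pow]
  simp [Nat.lt_succ_of_le hr]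

/-- Every $1/(\gamma)_{n-s+r}$ is brought to the denominator $(\gamma)_{n+r}$, independent of $s$;
the price is the falling factorial of length $s$ at $\gamma+n+r-1$. This is the form required by
`pow_dvd_iff_sum_descPochhammer` with $a=\gamma+n-1$. -/
theorem coeff_mul_mittagLefflerSeries (hγ : ∀ p : ℕ, γ ≠ -(p : ℝ)) (x : ℝ) {Q : ℂ[X]} {d s : ℕ}
    (hQ : Q.natDegree ≤ d) (hs : s ≤ n) :
    PowerSeries.coeff (n + d - s) ((Q : PowerSeries ℂ) * mittagLefflerSeries γ x) =
      (x : ℂ) ^ (n - s) * ∑ r ∈ Finset.range (d + 1), (dualPoly γ n d Q).coeff r * (x : ℂ) ^ r *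
        (descPochhammer ℂ s).eval (((γ + n - 1 : ℝ) : ℂ) + r) := by
  rw [coeff_coe_mul_of_le hQ (by omega), Finset.mul_sum]
  refine Finset.sum_congr rfl fun r hr => ?_
  have hr' : r ≤ d := by simpa [Nat.lt_succ_iff] using hr
  have h1 : n + d - s - d + r = n - s + r := by omega
  have h2 := poch_eq_mul_descPochhammer γ (n - s + r) s
  have h3 : n - s + r + s = n + r := by omega
  have h4 : γ + (n - s + r : ℕ) + s - 1 = γ + n - 1 + r := by
    push_cast [hs]
    ring
  rw [h3, h4] at h2
  have h5 : (((descPochhammer ℝ s).eval (γ + n - 1 + r) : ℝ) : ℂ) =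
      (descPochhammer ℂ s).eval (((γ + n - 1 : ℝ) : ℂ) + r) := by
    have := Polynomial.eval_map_apply (f := Complex.ofRealHom) (p := descPochhammer ℝ s)
      (γ + n - 1 + r)
    rw [descPochhammer_map] at this
    rw [← Complex.ofRealHom_eq_coe, ← this]
    simp
  rw [coeff_dualPoly hr', ← h5, h2, h1, mittagLefflerSeries, PowerSeries.coeff_mk]
  have h6 : (poch γ (n - s + r) : ℂ) ≠ 0 := by exact_mod_cast poch_ne_zero hγ _
  have h7 : (((descPochhammer ℝ s).eval (γ + n - 1 + r) : ℝ) : ℂ) ≠ 0 := by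
    have := poch_ne_zero hγ (n + r)
    rw [h2] at this
    exact_mod_cast right_ne_zero_of_mul this
  rw [Complex.ofReal_mul, Complex.ofReal_div, Complex.ofReal_pow]
  field_simp
  ring

theorem dualPoly_padeDenom (hγ : ∀ p : ℕ, γ ≠ -(p : ℝ)) :
    dualPoly γ n (∑ i, m i) ((padeDenom γ lam n m).map Complex.ofRealHom) =
      C ((poch γ (n + ∑ i, m i) : ℂ)⁻¹) * (nodePoly lam m).map Complex.ofRealHom := by
  ext r
  rw [coeff_C_mul, coeff_map]
  rcases le_or_gt r (∑ i, m i) with hr | hr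
  · rw [coeff_dualPoly hr, coeff_map, coeff_padeDenom (Nat.sub_le _ _), Nat.sub_sub_self hr]
    have h1 : (poch γ (n + r) : ℂ) ≠ 0 := by exact_mod_cast poch_ne_zero hγ _
    have h2 : (poch γ (n + ∑ i, m i) : ℂ) ≠ 0 := by exact_mod_cast poch_ne_zero hγ _
    simp only [Complex.ofRealHom_eq_coe]
    push_cast
    field_simp
  · rw [coeff_eq_zero_of_natDegree_lt ((natDegree_dualPoly_le _ _ _ _).trans_lt hr),
      coeff_eq_zero_of_natDegree_lt (by rwa [natDegree_nodePoly])]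
    simp

theorem map_nodePoly : (nodePoly lam m).map Complex.ofRealHom =
    ∏ p, (X - C (lam p : ℂ)) ^ m p := by
  simp [nodePoly, Polynomial.map_prod]

theorem nodePoly_dvd_iff (hlam : Function.Injective lam) (A : ℂ[X]) :
    (nodePoly lam m).map Complex.ofRealHom ∣ A ↔ ∀ j, (X - C (lam j : ℂ)) ^ m j ∣ A := by
  rw [map_nodePoly]
  constructor
  · intro h j
    exact (Finset.dvd_prod_of_mem (fun p => (X - C (lam p : ℂ)) ^ m p) (Finset.mem_univ j)).trans h
  · intro h
    refine Finset.prod_dvd_of_coprime (fun i _ j _ hij => ?_) fun j _ => h j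
    have h1 : (lam i : ℂ) - lam j ≠ 0 :=
      sub_ne_zero.2 fun h => hij (hlam (Complex.ofReal_injective h))
    have h2 : IsCoprime (X - C (lam i : ℂ)) (X - C (lam j : ℂ)) :=
      isCoprime_X_sub_C_of_isUnit_sub h1.isUnit
    exact h2.pow

/-- The order conditions on a Hermite–Padé denominator of the Mittag-Leffler system. -/
theorem nodePoly_dvd_dualPoly_iff (hγ : ∀ p : ℕ, γ ≠ -(p : ℝ)) (hlam : Function.Injective lam)
    (hlam0 : ∀ j, lam j ≠ 0) (hm : ∀ j, m j ≤ n) {Q : ℂ[X]} (hQ : Q.natDegree ≤ ∑ i, m i) :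
    (nodePoly lam m).map Complex.ofRealHom ∣ dualPoly γ n (∑ i, m i) Q ↔
      ∀ j, ∀ l, n + ∑ i, m i - m j < l → l ≤ n + ∑ i, m i →
        PowerSeries.coeff l ((Q : PowerSeries ℂ) * mittagLefflerSeries γ (lam j)) = 0 := by
  rw [nodePoly_dvd_iff hlam]
  refine forall_congr' fun j => ?_
  have hx : (lam j : ℂ) ≠ 0 := by exact_mod_cast hlam0 j
  have hj := hm j
  rw [pow_dvd_iff_sum_descPochhammer hx (m j) (∑ i, m i) ((γ + n - 1 : ℝ) : ℂ) _
    (natDegree_dualPoly_le _ _ _ _)]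
  constructor
  · intro h l hl1 hl2
    -- Here $s<m_j\le n$, so no truncated subtraction occurs in $n-s$.
    obtain ⟨s, rfl⟩ : ∃ s, l = n + ∑ i, m i - s := ⟨n + ∑ i, m i - l, by omega⟩
    rw [coeff_mul_mittagLefflerSeries hγ _ hQ (by omega), h s (by omega), mul_zero]
  · intro h s hs
    have h1 := h (n + ∑ i, m i - s) (by omega) (by omega)
    rw [coeff_mul_mittagLefflerSeries hγ _ hQ (by omega)] at h1
    exact (mul_eq_zero.1 h1).resolve_left (pow_ne_zero _ hx)

theorem isHermitePade_of_coeff {f : Fin k → PowerSeries ℂ} {Q : ℂ[X]} (hQ0 : Q ≠ 0)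
    (hQ : Q.natDegree ≤ ∑ i, m i) (h : ∀ j, ∀ l, n + ∑ i, m i - m j < l → l ≤ n + ∑ i, m i →
        PowerSeries.coeff l ((Q : PowerSeries ℂ) * f j) = 0) :
    IsHermitePade f n m Q fun j =>
      PowerSeries.trunc (n + ∑ i, m i - m j + 1) ((Q : PowerSeries ℂ) * f j) where
  ne_zero := hQ0
  natDegree_denom := hQ
  natDegree_num j := Nat.lt_succ_iff.1 (PowerSeries.natDegree_trunc_lt _ _)
  order j := by
    rw [PowerSeries.X_pow_dvd_iff]
    intro l hl
    rw [map_sub, coeff_coe, PowerSeries.coeff_trunc]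
    split_ifs with h1
    · exact sub_self _
    · rw [h j l (by omega) (by omega), sub_zero]

theorem IsHermitePade.coeff_eq_zero {f : Fin k → PowerSeries ℂ} {Q : ℂ[X]} {P : Fin k → ℂ[X]}
    (h : IsHermitePade f n m Q P) (j : Fin k) (l : ℕ) (hl : n + ∑ i, m i - m j < l)
    (hl' : l ≤ n + ∑ i, m i) : PowerSeries.coeff l ((Q : PowerSeries ℂ) * f j) = 0 := by
  have h1 := PowerSeries.X_pow_dvd_iff.1 (h.order j) l (by omega)
  rwa [map_sub, coeff_coe, coeff_eq_zero_of_natDegree_lt ((h.natDegree_num j).trans_lt hl),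
    sub_zero] at h1

theorem isHermitePade_padeDenom (hγ : ∀ p : ℕ, γ ≠ -(p : ℝ)) (hlam : Function.Injective lam)
    (hlam0 : ∀ j, lam j ≠ 0) (hm : ∀ j, m j ≤ n) :
    ∃ P, IsHermitePade (fun j => mittagLefflerSeries γ (lam j)) n m
      ((padeDenom γ lam n m).map Complex.ofRealHom) P := by
  have hd : ((padeDenom γ lam n m).map Complex.ofRealHom).natDegree ≤ ∑ i, m i :=
    natDegree_map_le.trans natDegree_padeDenom_le
  refine ⟨_, isHermitePade_of_coeff ?_ hd
    ((nodePoly_dvd_dualPoly_iff hγ hlam hlam0 hm hd).1 ?_)⟩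
  · intro h0
    have h1 := eval_zero_padeDenom (lam := lam) (n := n) (m := m) hγ
    rw [(Polynomial.map_eq_zero Complex.ofRealHom).1 h0] at h1
    simp at h1
  · rw [dualPoly_padeDenom hγ]
    exact dvd_mul_left _ _

/-- The dual polynomial has degree at most $d$ and is divisible by a monic polynomial of degree $d$,
so the cofactor is constant. -/
theorem IsHermitePade.eq_C_mul_padeDenom (hγ : ∀ p : ℕ, γ ≠ -(p : ℝ))
    (hlam : Function.Injective lam) (hlam0 : ∀ j, lam j ≠ 0) (hm : ∀ j, m j ≤ n)
    {Q : ℂ[X]} {P : Fin k → ℂ[X]}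
    (h : IsHermitePade (fun j => mittagLefflerSeries γ (lam j)) n m Q P) :
    ∃ c : ℂ, Q = C c * (padeDenom γ lam n m).map Complex.ofRealHom := by
  obtain ⟨D, hD⟩ := (nodePoly_dvd_dualPoly_iff hγ hlam hlam0 hm h.natDegree_denom).2
    h.coeff_eq_zero
  have hB : ((nodePoly lam m).map Complex.ofRealHom).Monic := (monic_nodePoly lam m).map _
  have hD0 : D.natDegree = 0 := by
    by_contra hne
    have hne' : D ≠ 0 := by
      rintro rfl
      simp at hne
    have h1 := natDegree_dualPoly_le γ n (∑ i, m i) Q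
    rw [hD, hB.natDegree_mul' hne', natDegree_map, natDegree_nodePoly] at h1
    omega
  obtain ⟨c, rfl⟩ := natDegree_eq_zero.1 hD0
  refine ⟨c * poch γ (n + ∑ i, m i), ?_⟩
  ext p
  rcases le_or_gt p (∑ i, m i) with hp | hp
  · have h1 := congrArg (fun A => A.coeff (∑ i, m i - p)) hD
    simp only [coeff_mul_C, coeff_map] at h1
    rw [coeff_dualPoly (Nat.sub_le _ _), Nat.sub_sub_self hp, div_eq_iff
      (by exact_mod_cast poch_ne_zero hγ _)] at h1
    rw [h1, coeff_C_mul, coeff_map, coeff_padeDenom hp]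
    have h2 : (poch γ (n + ∑ i, m i) : ℂ) ≠ 0 := by exact_mod_cast poch_ne_zero hγ _
    simp only [Complex.ofRealHom_eq_coe]
    push_cast
    field_simp
  · rw [coeff_eq_zero_of_natDegree_lt (h.natDegree_denom.trans_lt hp), coeff_C_mul,
      coeff_eq_zero_of_natDegree_lt ((natDegree_map_le.trans natDegree_padeDenom_le).trans_lt hp),
      mul_zero]

end

/-! ### Absence of zeros of the denominators in the closed unit disc -/

theorem tendsto_pow_mul_poch_div_poch {γ : ℝ} (hγ : ∀ p : ℕ, γ ≠ -(p : ℝ)) (p : ℕ) :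
    Filter.Tendsto (fun N : ℕ => (N : ℝ) ^ p * (poch γ (N - p) / poch γ N)) Filter.atTop
      (nhds 1) := by
  induction p with
  | zero =>
    simp only [pow_zero, Nat.sub_zero, one_mul]
    exact (tendsto_const_nhds (x := (1 : ℝ))).congr fun N => (div_self (poch_ne_zero hγ N)).symm
  | succ p ih =>
    have h1 : Filter.Tendsto (fun N : ℕ => (N : ℝ) / (N + (γ - p - 1))) Filter.atTop (nhds 1) :=
      tendsto_natCast_div_add_atTop _
    have h2 := ih.mul h1
    rw [one_mul] at h2
    refine h2.congr' ?_
    filter_upwards [Filter.eventually_ge_atTop (p + 1)] with N hN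
    obtain ⟨q, rfl⟩ : ∃ q, N = q + (p + 1) := ⟨N - (p + 1), by omega⟩
    have h3 : poch γ (q + (p + 1) - p) = poch γ q * (γ + q) := by
      rw [← poch_succ]
      congr 1
      omega
    rw [h3, Nat.add_sub_cancel]
    have h4 : ((q + (p + 1) : ℕ) : ℝ) + (γ - p - 1) = γ + q := by
      push_cast
      ring
    rw [h4]
    have h5 : γ + q ≠ 0 := fun h => hγ q (by linarith)
    field_simp
    ring

/-- The last $p$ factors of $(\gamma)_{n+d}$ dominate $d,d-1,\dots,d-p+1$ one by one. This absorbs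
the binomial coefficient in `abs_coeff_nodePoly_le` and yields a bound free of $n$ and $\vec m$. -/
theorem descFactorial_mul_abs_poch_le {γ : ℝ} {n d p : ℕ} (hn : 1 ≤ γ + n) (hp : p ≤ d) :
    (d.descFactorial p : ℝ) * |poch γ (n + d - p)| ≤ |poch γ (n + d)| := by
  induction p with
  | zero => simp
  | succ p ih =>
    refine le_trans ?_ (ih (by omega))
    have h1 : n + d - p = n + d - (p + 1) + 1 := by omega
    rw [h1, poch_succ, abs_mul, Nat.descFactorial_succ]
    have h2 : ((d - p : ℕ) : ℝ) ≤ |γ + (n + d - (p + 1) : ℕ)| := by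
      refine le_trans ?_ (le_abs_self _)
      rw [Nat.cast_sub (by omega), Nat.cast_sub (by omega)]
      push_cast
      linarith
    push_cast
    calc ((d - p : ℕ) : ℝ) * (d.descFactorial p) * |poch γ (n + d - (p + 1))|
        ≤ |γ + (n + d - (p + 1) : ℕ)| * (d.descFactorial p) * |poch γ (n + d - (p + 1))| := by
          gcongr
      _ = _ := by ring

theorem sum_coeff_sub_mul_pow {R : Type*} [Field R] {B : R[X]} {d : ℕ} (hB : B.natDegree ≤ d)
    {w : R} (hw : w ≠ 0) :
    ∑ p ∈ Finset.range (d + 1), B.coeff (d - p) * w ^ p = w ^ d * B.eval w⁻¹ := by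
  rw [eval_eq_sum_range' (Nat.lt_succ_of_le hB), ← Finset.sum_range_reflect, Finset.mul_sum]
  refine Finset.sum_congr rfl fun r hr => ?_
  have hr' : r ≤ d := by simpa [Nat.lt_succ_iff] using hr
  rw [show d + 1 - 1 - r = d - r by omega, Nat.sub_sub_self hr', inv_pow,
    ← div_eq_mul_inv, mul_div_assoc', mul_comm (w ^ d), mul_div_assoc, pow_sub₀ w hw hr', div_eq_mul_inv]

section

variable {k : ℕ} {γ : ℝ} {lam : Fin k → ℝ} {n : ℕ} {m : Fin k → ℕ}

theorem abs_coeff_nodePoly_le {Λ : ℝ} (hΛ : ∀ j, |lam j| ≤ Λ) {p : ℕ} (hp : p ≤ ∑ i, m i) :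
    |(nodePoly lam m).coeff (∑ i, m i - p)| ≤ Λ ^ p * (∑ i, m i).choose p := by
  have h := coeff_le_of_roots_le (p := nodePoly lam m) (f := RingHom.id ℝ) (B := Λ)
    (∑ i, m i - p) (monic_nodePoly lam m) ?_ ?_
  · rw [natDegree_nodePoly, Nat.sub_sub_self hp, Nat.choose_symm hp, Polynomial.map_id] at h
    simpa using h
  · rw [Polynomial.map_id, nodePoly]
    exact Splits.prod fun j _ => (Splits.X_sub_C _).pow _
  · intro z hz
    rw [Polynomial.map_id] at hz
    have h1 : (nodePoly lam m).eval z = 0 := isRoot_of_mem_roots hz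
    rw [nodePoly, eval_prod, Finset.prod_eq_zero_iff] at h1
    obtain ⟨j, -, hj⟩ := h1
    have h2 : z - lam j = 0 := by simpa using eq_zero_of_pow_eq_zero (by simpa using hj)
    rw [sub_eq_zero.1 h2]
    exact hΛ j

theorem sum_coeff_nodePoly_mul_pow {w : ℂ} (hw : w ≠ 0) :
    ∑ p ∈ Finset.range (∑ i, m i + 1), ((nodePoly lam m).coeff (∑ i, m i - p) : ℂ) * w ^ p =
      ∏ j, (1 - lam j * w) ^ m j := by
  have h := sum_coeff_sub_mul_pow (B := (nodePoly lam m).map Complex.ofRealHom)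
    (d := ∑ i, m i) (by rw [natDegree_map, natDegree_nodePoly]) hw
  simp only [coeff_map, Complex.ofRealHom_eq_coe] at h
  rw [h, map_nodePoly, eval_prod, ← Finset.prod_pow_eq_pow_sum, ← Finset.prod_mul_distrib]
  refine Finset.prod_congr rfl fun j _ => ?_
  rw [eval_pow, ← mul_pow]
  congr 1
  simp only [eval_sub, eval_X, eval_C]
  field_simp

/-- Each of the at most $N$ factors has modulus at least $1-\Lambda/N\ge e^{-2\Lambda/N}$. -/
theorem exp_neg_le_norm_prod {Λ N : ℝ} (hΛ : ∀ j, |lam j| ≤ Λ) (hΛ0 : 0 < Λ) (hN : 2 * Λ ≤ N)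
    (hmN : (∑ i, m i : ℕ) ≤ N) {w : ℂ} (hw : ‖w‖ ≤ 1 / N) :
    Real.exp (-(2 * Λ)) ≤ ‖∏ j, (1 - lam j * w) ^ m j‖ := by
  have hN0 : 0 < N := by linarith
  have h1 : ∀ j, Real.exp (-(2 * (Λ / N))) ≤ ‖1 - lam j * w‖ := by
    intro j
    have h2 : ‖(lam j : ℂ) * w‖ ≤ Λ / N := by
      rw [norm_mul, Complex.norm_real, Real.norm_eq_abs, div_eq_mul_one_div]
      exact mul_le_mul (hΛ j) hw (norm_nonneg _) hΛ0.le
    have h3 : 1 - Λ / N ≤ ‖1 - lam j * w‖ := by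
      have := norm_sub_norm_le (1 : ℂ) (lam j * w)
      rw [norm_one] at this
      linarith
    refine le_trans ?_ h3
    set x := Λ / N with hx
    have hx0 : 0 ≤ x := by positivity
    have hx1 : x ≤ 1 / 2 := by
      rw [hx, div_le_iff₀ hN0]
      linarith
    -- For $0\le x\le 1/2$ one has $1/(1-x)\le 1+2x\le e^{2x}$.
    rw [Real.exp_neg, inv_le_comm₀ (Real.exp_pos _) (by linarith)]
    refine le_trans ?_ (Real.add_one_le_exp _)
    rw [inv_le_iff_one_le_mul₀ (by linarith)]
    nlinarith
  calc Real.exp (-(2 * Λ)) ≤ Real.exp (-(2 * (Λ / N))) ^ (∑ i, m i) := by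
        rw [← Real.exp_nat_mul, Real.exp_le_exp]
        have : ((∑ i, m i : ℕ) : ℝ) * (Λ / N) ≤ Λ := by
          rw [mul_div_assoc', div_le_iff₀ hN0, mul_comm]
          exact mul_le_mul_of_nonneg_left hmN hΛ0.le
        linarith
    _ = ∏ j, Real.exp (-(2 * (Λ / N))) ^ m j := by rw [Finset.prod_pow_eq_pow_sum]
    _ ≤ ∏ j, ‖(1 - lam j * w) ^ m j‖ := by
        refine Finset.prod_le_prod (fun j _ => by positivity) fun j _ => ?_
        rw [norm_pow]
        exact pow_le_pow_left₀ (Real.exp_pos _).le (h1 j) _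
    _ = _ := (norm_prod _ _).symm

/-- The distance of the `p`-th coefficients of the denominator and of
`∏ (1 - lam_j z / (n + |m|))^{m_j}`. -/
def denomError (γ : ℝ) (lam : Fin k → ℝ) (x : ℕ × (Fin k → ℕ)) (p : ℕ) : ℝ :=
  if p ≤ ∑ i, x.2 i then |(nodePoly lam x.2).coeff (∑ i, x.2 i - p)| *
    |poch γ (x.1 + ∑ i, x.2 i - p) / poch γ (x.1 + ∑ i, x.2 i) -
      1 / ((x.1 + ∑ i, x.2 i : ℕ) : ℝ) ^ p| else 0

theorem denomError_nonneg (x : ℕ × (Fin k → ℕ)) (p : ℕ) : 0 ≤ denomError γ lam x p := by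
  rw [denomError]
  split_ifs <;> positivity

theorem choose_div_pow_le {n d p : ℕ} : (d.choose p : ℝ) / ((n + d : ℕ) : ℝ) ^ p ≤
    1 / p.factorial := by
  refine div_le_of_le_mul₀ (by positivity) (by positivity) ?_
  refine (Nat.choose_le_pow_div (α := ℝ) p d).trans ?_
  rw [div_mul_eq_mul_div, one_mul]
  gcongr
  omega

/-- Summable majorant for dominated convergence: each of the two coefficients compared is at most
$\Lambda^p/p!$. -/
theorem denomError_le_bound {Λ : ℝ} (hΛ : ∀ j, |lam j| ≤ Λ) (hΛ0 : 0 < Λ)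
    (hγ : ∀ p : ℕ, γ ≠ -(p : ℝ)) {x : ℕ × (Fin k → ℕ)} (hx : 1 ≤ γ + x.1) (p : ℕ) :
    denomError γ lam x p ≤ 2 * (Λ ^ p / p.factorial) := by
  obtain ⟨n, m⟩ := x
  rw [denomError]
  split_ifs with hp
  swap
  · positivity
  simp only at hp hx ⊢
  set d := ∑ i, m i
  have h1 : (d.choose p : ℝ) * |poch γ (n + d - p) / poch γ (n + d)| ≤ 1 / p.factorial := by
    have h2 := descFactorial_mul_abs_poch_le hx hp
    rw [Nat.descFactorial_eq_factorial_mul_choose] at h2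
    have h3 : 0 < |poch γ (n + d)| := abs_pos.2 (poch_ne_zero hγ _)
    have h4 : (0 : ℝ) < p.factorial := by exact_mod_cast p.factorial_pos
    rw [abs_div, mul_div_assoc', div_le_div_iff₀ h3 h4]
    push_cast at h2
    linarith
  have h5 : |poch γ (n + d - p) / poch γ (n + d) - 1 / ((n + d : ℕ) : ℝ) ^ p| ≤
      |poch γ (n + d - p) / poch γ (n + d)| + 1 / ((n + d : ℕ) : ℝ) ^ p := by
    refine (abs_sub _ _).trans_eq ?_
    rw [abs_of_nonneg (by positivity : (0 : ℝ) ≤ 1 / ((n + d : ℕ) : ℝ) ^ p)]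
  have h6 := choose_div_pow_le (n := n) (d := d) (p := p)
  calc _ ≤ Λ ^ p * d.choose p * (|poch γ (n + d - p) / poch γ (n + d)| +
        1 / ((n + d : ℕ) : ℝ) ^ p) :=
        mul_le_mul (abs_coeff_nodePoly_le hΛ hp) h5 (abs_nonneg _) (by positivity)
    _ = Λ ^ p * (d.choose p * |poch γ (n + d - p) / poch γ (n + d)| +
        d.choose p / ((n + d : ℕ) : ℝ) ^ p) := by ring
    _ ≤ Λ ^ p * (1 / p.factorial + 1 / p.factorial) := by gcongr
    _ = _ := by ring

theorem denomError_le_pointwise {Λ : ℝ} (hΛ : ∀ j, |lam j| ≤ Λ) (hΛ0 : 0 < Λ)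
    {x : ℕ × (Fin k → ℕ)} (hx : 0 < x.1) (p : ℕ) :
    denomError γ lam x p ≤ Λ ^ p * |((x.1 + ∑ i, x.2 i : ℕ) : ℝ) ^ p *
      (poch γ (x.1 + ∑ i, x.2 i - p) / poch γ (x.1 + ∑ i, x.2 i)) - 1| := by
  obtain ⟨n, m⟩ := x
  rw [denomError]
  split_ifs with hp
  swap
  · positivity
  simp only at hp hx ⊢
  set d := ∑ i, m i
  have hN : (0 : ℝ) < ((n + d : ℕ) : ℝ) ^ p := by
    have : (0 : ℝ) < ((n + d : ℕ) : ℝ) := by exact_mod_cast Nat.add_pos_left hx d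
    positivity
  have h1 : poch γ (n + d - p) / poch γ (n + d) - 1 / ((n + d : ℕ) : ℝ) ^ p =
      (((n + d : ℕ) : ℝ) ^ p * (poch γ (n + d - p) / poch γ (n + d)) - 1) /
        ((n + d : ℕ) : ℝ) ^ p := by
    field_simp
  rw [h1, abs_div, abs_of_pos hN]
  set E := |((n + d : ℕ) : ℝ) ^ p * (poch γ (n + d - p) / poch γ (n + d)) - 1|
  have h6 := choose_div_pow_le (n := n) (d := d) (p := p)
  have h7 : (1 : ℝ) / p.factorial ≤ 1 := by
    rw [div_le_one (by exact_mod_cast p.factorial_pos)]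
    exact_mod_cast p.factorial_pos
  calc _ ≤ Λ ^ p * d.choose p * (E / ((n + d : ℕ) : ℝ) ^ p) :=
        mul_le_mul_of_nonneg_right (abs_coeff_nodePoly_le hΛ hp) (by positivity)
    _ = Λ ^ p * E * (d.choose p / ((n + d : ℕ) : ℝ) ^ p) := by ring
    _ ≤ Λ ^ p * E * 1 := by
        gcongr
        exact h6.trans h7
    _ = _ := mul_one _

/-- Dominated convergence for series. The filter `comap Prod.fst atTop` leaves $\vec m$ free while
$n\to\infty$, so the limit is uniform in $\vec m$. -/
theorem tendsto_tsum_denomError (hγ : ∀ p : ℕ, γ ≠ -(p : ℝ)) {Λ : ℝ} (hΛ : ∀ j, |lam j| ≤ Λ)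
    (hΛ0 : 0 < Λ) : Filter.Tendsto (fun x => ∑' p, denomError γ lam x p)
      (Filter.comap Prod.fst Filter.atTop) (nhds 0) := by
  have hfst : Filter.Tendsto (Prod.fst : ℕ × (Fin k → ℕ) → ℕ)
    (Filter.comap Prod.fst Filter.atTop) Filter.atTop := Filter.tendsto_comap
  have hN : Filter.Tendsto (fun x : ℕ × (Fin k → ℕ) => x.1 + ∑ i, x.2 i)
      (Filter.comap Prod.fst Filter.atTop) Filter.atTop :=
    Filter.tendsto_atTop_mono (fun x => Nat.le_add_right _ _) hfst
  have h := tendsto_tsum_of_dominated_convergence (𝓕 := Filter.comap Prod.fst Filter.atTop)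
    (f := fun x p => denomError γ lam x p) (g := fun _ => 0)
    (bound := fun p => 2 * (Λ ^ p / p.factorial))
    ((Real.summable_pow_div_factorial Λ).mul_left 2) ?_ ?_
  · simpa using h
  · intro p
    refine squeeze_zero' (Filter.Eventually.of_forall fun x => denomError_nonneg x p)
      ((hfst.eventually (Filter.eventually_gt_atTop 0)).mono fun x hx =>
        denomError_le_pointwise hΛ hΛ0 hx p) ?_
    have h1 := ((tendsto_pow_mul_poch_div_poch hγ p).comp hN).sub_const 1
    rw [sub_self] at h1
    have h2 := h1.abs.const_mul (Λ ^ p)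
    rw [abs_zero, mul_zero] at h2
    exact h2
  · have h1 : ∀ᶠ n : ℕ in Filter.atTop, 1 ≤ γ + n := by
      have := tendsto_natCast_atTop_atTop (R := ℝ)
      filter_upwards [this.eventually_ge_atTop (1 - γ)] with n hn
      linarith
    filter_upwards [hfst.eventually h1] with x hx p
    rw [Real.norm_of_nonneg (denomError_nonneg x p)]
    exact denomError_le_bound hΛ hΛ0 hγ hx p

theorem exists_forall_eval_padeDenom_ne_zero (hγ : ∀ p : ℕ, γ ≠ -(p : ℝ)) (lam : Fin k → ℝ) :
    ∃ n₀ : ℕ, ∀ n, n₀ ≤ n → ∀ m : Fin k → ℕ, ∀ z : ℂ, ‖z‖ ≤ 1 →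
      ((padeDenom γ lam n m).map Complex.ofRealHom).eval z ≠ 0 := by
  obtain ⟨Λ, hΛ0, hΛ⟩ : ∃ Λ : ℝ, 0 < Λ ∧ ∀ j, |lam j| ≤ Λ := by
    refine ⟨∑ j, |lam j| + 1, by positivity, fun j => ?_⟩
    have := Finset.single_le_sum (f := fun j => |lam j|) (fun i _ => abs_nonneg _)
      (Finset.mem_univ j)
    linarith
  have h1 := (tendsto_tsum_denomError (k := k) hγ hΛ hΛ0).eventually
    (gt_mem_nhds (Real.exp_pos (-(2 * Λ))))
  rw [Filter.eventually_comap] at h1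
  have h2 := (tendsto_natCast_atTop_atTop (R := ℝ)).eventually_ge_atTop (2 * Λ)
  obtain ⟨n₀, hn₀⟩ := Filter.eventually_atTop.1 (h1.and h2)
  refine ⟨n₀, fun n hn m z hz h0 => ?_⟩
  obtain ⟨h3, h4⟩ := hn₀ n hn
  have h5 := h3 (n, m) rfl
  have hz0 : z ≠ 0 := by
    rintro rfl
    have := eval_zero_padeDenom (lam := lam) (n := n) (m := m) hγ
    rw [← Complex.ofReal_zero, ← Complex.ofRealHom_eq_coe, eval_map_apply, this] at h0
    simp at h0
  set d := ∑ i, m i with hd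
  have hnd : (n : ℝ) ≤ ((n + d : ℕ) : ℝ) := by exact_mod_cast Nat.le_add_right n d
  have hN0 : (0 : ℝ) < ((n + d : ℕ) : ℝ) := by linarith
  have hN0' : ((n + d : ℕ) : ℂ) ≠ 0 := by exact_mod_cast hN0.ne'
  have h6 := exp_neg_le_norm_prod (m := m) hΛ hΛ0 (h4.trans hnd)
    (by exact_mod_cast Nat.le_add_left _ _) (w := z / ((n + d : ℕ) : ℂ)) (by
      rw [norm_div, Complex.norm_natCast]
      gcongr)
  rw [← sum_coeff_nodePoly_mul_pow (div_ne_zero hz0 hN0')] at h6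
  have h7 : (∑' p, denomError γ lam (n, m) p) =
      ∑ p ∈ Finset.range (d + 1), denomError γ lam (n, m) p := by
    refine tsum_eq_sum fun p hp => ?_
    rw [denomError, if_neg]
    simpa [Nat.lt_succ_iff] using hp
  rw [eval_eq_sum_range' (Nat.lt_succ_of_le (natDegree_map_le.trans natDegree_padeDenom_le))] at h0
  have h8 : ‖∑ p ∈ Finset.range (d + 1), ((nodePoly lam m).coeff (d - p) : ℂ) *
      (z / ((n + d : ℕ) : ℂ)) ^ p‖ ≤ ∑ p ∈ Finset.range (d + 1), denomError γ lam (n, m) p := by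
    -- At a zero $z$ of $Q_m$ the comparison product equals minus the difference of the two
    -- polynomials, hence is below $e^{-2\Lambda}$, against `h6`.
    rw [← norm_neg, ← zero_sub, ← h0, ← Finset.sum_sub_distrib]
    refine norm_sum_le_of_le _ fun p hp => ?_
    have hp' : p ≤ d := by simpa [Nat.lt_succ_iff] using hp
    rw [coeff_map, coeff_padeDenom hp', denomError, if_pos hp']
    have h9 : Complex.ofRealHom ((nodePoly lam m).coeff (d - p) *
        (poch γ (n + (d - p)) / poch γ (n + d))) * z ^ p -
        ((nodePoly lam m).coeff (d - p) : ℂ) * (z / ((n + d : ℕ) : ℂ)) ^ p =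
        (((nodePoly lam m).coeff (d - p) * (poch γ (n + d - p) / poch γ (n + d) -
          1 / ((n + d : ℕ) : ℝ) ^ p) : ℝ) : ℂ) * z ^ p := by
      rw [← Nat.add_sub_assoc hp']
      simp only [Complex.ofRealHom_eq_coe]
      push_cast
      rw [div_pow]
      ring
    rw [← hd, h9, norm_mul, Complex.norm_real, Real.norm_eq_abs, abs_mul, norm_pow]
    exact mul_le_of_le_one_right (by positivity) (pow_le_one₀ (norm_nonneg _) hz)
  rw [h7] at h5
  linarith

end

/-! ### Fourier coefficients on the circle -/

/-- The Fourier coefficient `∫_0^{2π} h(θ) e^{-ilθ} dθ`. -/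
def circleCoeff (h : ℝ → ℂ) (l : ℤ) : ℂ :=
  ∫ θ in (0 : ℝ)..2 * Real.pi, h θ * Complex.exp (-(l * θ * Complex.I))

theorem circleCoeff_add {g h : ℝ → ℂ} (hg : Continuous g) (hh : Continuous h) (l : ℤ) :
    circleCoeff (fun θ => g θ + h θ) l = circleCoeff g l + circleCoeff h l := by
  rw [circleCoeff, circleCoeff, circleCoeff, ← intervalIntegral.integral_add
    (Continuous.intervalIntegrable (by fun_prop) _ _)
    (Continuous.intervalIntegrable (by fun_prop) _ _)]
  simp only [add_mul]

theorem circleCoeff_const_mul (c : ℂ) (h : ℝ → ℂ) (l : ℤ) :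
    circleCoeff (fun θ => c * h θ) l = c * circleCoeff h l := by
  rw [circleCoeff, circleCoeff, ← intervalIntegral.integral_const_mul]
  simp only [mul_assoc]

theorem circleCoeff_sum {ι : Type*} (s : Finset ι) {g : ι → ℝ → ℂ}
    (hg : ∀ i ∈ s, Continuous (g i)) (l : ℤ) :
    circleCoeff (fun θ => ∑ i ∈ s, g i θ) l = ∑ i ∈ s, circleCoeff (g i) l := by
  simp only [circleCoeff, Finset.sum_mul]
  exact intervalIntegral.integral_finsetSum fun i hi =>
    Continuous.intervalIntegrable (by have := hg i hi; fun_prop) _ _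

theorem circleCoeff_exp_mul (p : ℤ) (h : ℝ → ℂ) (l : ℤ) :
    circleCoeff (fun θ => Complex.exp (p * θ * Complex.I) * h θ) l = circleCoeff h (l - p) := by
  refine intervalIntegral.integral_congr fun θ _ => ?_
  simp only
  rw [mul_comm (Complex.exp _) (h θ), mul_assoc, ← Complex.exp_add]
  congr 2
  push_cast
  ring

theorem circleCoeff_one (l : ℤ) :
    circleCoeff (fun _ => 1) l = if l = 0 then 2 * (Real.pi : ℂ) else 0 := by
  simp only [circleCoeff, one_mul]
  split_ifs with hl
  · simp [hl]
  · have hc : -((l : ℂ) * Complex.I) ≠ 0 := by simp [hl]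
    have h1 := integral_exp_mul_complex (a := 0) (b := 2 * Real.pi) hc
    have h2 : Complex.exp (-((l : ℂ) * Complex.I) * (2 * Real.pi : ℝ)) = 1 := by
      rw [Complex.exp_eq_one_iff]
      exact ⟨-l, by push_cast; ring⟩
    rw [h2] at h1
    simp only [Complex.ofReal_zero, mul_zero, Complex.exp_zero, sub_self, zero_div] at h1
    rw [← h1]
    refine intervalIntegral.integral_congr fun θ _ => ?_
    congr 1
    ring

theorem circleCoeff_cos_mul (p : ℤ) {h : ℝ → ℂ} (hh : Continuous h) (l : ℤ) :
    circleCoeff (fun θ => (Real.cos (p * θ) : ℂ) * h θ) l =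
      (circleCoeff h (l - p) + circleCoeff h (l + p)) / 2 := by
  have h1 : ∀ θ : ℝ, (Real.cos (p * θ) : ℂ) * h θ = 1 / 2 *
      (Complex.exp ((p : ℤ) * θ * Complex.I) * h θ +
        Complex.exp ((-p : ℤ) * θ * Complex.I) * h θ) := by
    intro θ
    rw [Complex.ofReal_cos, Complex.cos]
    push_cast
    ring_nf
  simp only [h1]
  rw [circleCoeff_const_mul, circleCoeff_add (by fun_prop) (by fun_prop), circleCoeff_exp_mul,
    circleCoeff_exp_mul, sub_neg_eq_add]
  ring

theorem exists_norm_circleCoeff_le (h : ℝ → ℂ) :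
    ∃ K, ∀ l, ‖circleCoeff h l‖ ≤ K := by
  refine ⟨∫ θ in (0 : ℝ)..2 * Real.pi, ‖h θ‖, fun l => ?_⟩
  refine (intervalIntegral.norm_integral_le_integral_norm (by positivity)).trans_eq ?_
  refine intervalIntegral.integral_congr fun θ _ => ?_
  have h1 : -((l : ℂ) * θ * Complex.I) = ((-(l * θ) : ℝ) : ℂ) * Complex.I := by
    push_cast
    ring
  rw [norm_mul, h1, Complex.norm_exp_ofReal_mul_I, mul_one]

/-! ### Chebyshev series -/

theorem chebT_cos (l : ℕ) (θ : ℝ) : chebT l (Real.cos θ) = Real.cos (l * θ) := by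
  rw [chebT, Polynomial.Chebyshev.T_real_cos]
  simp

theorem chebT_one (l : ℕ) : chebT l 1 = 1 := by
  simp [chebT]

theorem norm_chebT_le {x : ℝ} (hx : x ∈ Set.Icc (-1 : ℝ) 1) (l : ℕ) : ‖(chebT l x : ℂ)‖ ≤ 1 := by
  rw [← Real.cos_arccos hx.1 hx.2, chebT_cos, Complex.norm_real]
  exact Real.abs_cos_le_one _

theorem summable_norm_of_hasSum_chebT {a : ℕ → ℂ} {s : ℂ}
    (h : HasSum (fun l => a l * (chebT l 1 : ℂ)) s) : Summable fun l => ‖a l‖ := by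
  have := h.summable.norm
  simpa [chebT_one] using this

theorem continuous_of_hasSum_chebT {a : ℕ → ℂ} (ha : Summable fun l => ‖a l‖) {h : ℝ → ℂ}
    (hh : ∀ θ, HasSum (fun l => a l * (chebT l (Real.cos θ) : ℂ)) (h θ)) : Continuous h := by
  have h1 : h = fun θ => ∑' l, a l * (chebT l (Real.cos θ) : ℂ) :=
    funext fun θ => (hh θ).tsum_eq.symm
  rw [h1]
  refine continuous_tsum (fun l => ?_) ha fun l θ => ?_
  · simp only [chebT_cos]
    fun_prop
  · rw [norm_mul]
    exact mul_le_of_le_one_right (norm_nonneg _)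
      (norm_chebT_le ⟨Real.neg_one_le_cos _, Real.cos_le_one _⟩ _)

/-- Termwise integration. The two indicators are the frequencies $\pm j$ of $\cos j\theta$; both
count when $l=j=0$. -/
theorem hasSum_circleCoeff {a : ℕ → ℂ} (ha : Summable fun l => ‖a l‖) {h : ℝ → ℂ}
    (hh : ∀ θ, HasSum (fun l => a l * (chebT l (Real.cos θ) : ℂ)) (h θ)) (l : ℤ) :
    HasSum (fun j : ℕ => a j * (Real.pi * ((if l = j then 1 else 0) + if l = -j then 1 else 0)))
      (circleCoeff h l) := by
  have h1 : ∀ j : ℕ, circleCoeff (fun θ => a j * (chebT j (Real.cos θ) : ℂ)) l =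
      a j * (Real.pi * ((if l = j then 1 else 0) + if l = -j then 1 else 0)) := by
    intro j
    rw [circleCoeff_const_mul]
    have h2 := circleCoeff_cos_mul j (h := fun _ => 1) continuous_const l
    simp only [mul_one, Int.cast_natCast] at h2
    simp only [chebT_cos]
    rw [h2, circleCoeff_one, circleCoeff_one]
    simp only [sub_eq_zero, add_eq_zero_iff_eq_neg]
    split_ifs <;> ring
  simp only [← h1]
  set F : ℕ → C(ℝ, ℂ) := fun j => ⟨fun θ => a j * (chebT j (Real.cos θ) : ℂ) *
    Complex.exp (-(l * θ * Complex.I)), by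
      simp only [chebT_cos]
      fun_prop⟩ with hF
  have hn : ∀ j θ, ‖F j θ‖ ≤ ‖a j‖ := by
    intro j θ
    have h3 : -((l : ℂ) * θ * Complex.I) = ((-(l * θ) : ℝ) : ℂ) * Complex.I := by
      push_cast
      ring
    simp only [hF, ContinuousMap.coe_mk]
    rw [norm_mul, h3, Complex.norm_exp_ofReal_mul_I, mul_one, norm_mul]
    exact mul_le_of_le_one_right (norm_nonneg _)
      (norm_chebT_le ⟨Real.neg_one_le_cos _, Real.cos_le_one _⟩ _)
  have h4 := intervalIntegral.hasSum_intervalIntegral_of_summable_norm (a := 0) (b := 2 * Real.pi)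
    (f := F) (ha.of_nonneg_of_le (fun _ => norm_nonneg _) fun j =>
      (ContinuousMap.norm_le _ (norm_nonneg _)).2 fun x => hn j x)
  have h5 : (∫ θ in (0 : ℝ)..2 * Real.pi, ∑' j, F j θ) = circleCoeff h l := by
    refine intervalIntegral.integral_congr fun θ _ => ?_
    simp only [hF, ContinuousMap.coe_mk]
    rw [tsum_mul_right, (hh θ).tsum_eq]
  rw [h5] at h4
  exact h4

theorem circleCoeff_eq_pi_mul {a : ℕ → ℂ} (ha : Summable fun l => ‖a l‖) {h : ℝ → ℂ}
    (hh : ∀ θ, HasSum (fun l => a l * (chebT l (Real.cos θ) : ℂ)) (h θ)) {l : ℕ} (hl : l ≠ 0) :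
    circleCoeff h l = Real.pi * a l := by
  refine (hasSum_circleCoeff ha hh l).unique ?_
  have h1 : (Real.pi : ℂ) * a l = a l * (Real.pi * ((if (l : ℤ) = l then 1 else 0) +
      if (l : ℤ) = -l then 1 else 0)) := by
    rw [if_pos rfl, if_neg (by omega)]
    ring
  rw [h1]
  refine hasSum_single l fun j hj => ?_
  rw [if_neg (by omega), if_neg (by omega)]
  ring

theorem circleCoeff_eq_zero {a : ℕ → ℂ} (ha : Summable fun l => ‖a l‖) {h : ℝ → ℂ}
    (hh : ∀ θ, HasSum (fun l => a l * (chebT l (Real.cos θ) : ℂ)) (h θ)) {N : ℕ}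
    (h0 : ∀ l < N, a l = 0) {l : ℤ} (hl : |l| < N) : circleCoeff h l = 0 := by
  refine (hasSum_circleCoeff ha hh l).unique ?_
  convert hasSum_zero with j
  rcases lt_or_ge j N with hj | hj
  · rw [h0 j hj, zero_mul]
  · rw [abs_lt] at hl
    rw [if_neg (by omega), if_neg (by omega)]
    ring

/-! ### Multiplication by polynomials -/

theorem circleCoeff_cos_pow_mul_eq_zero {h : ℝ → ℂ} (hh : Continuous h) {L : ℤ}
    (h0 : ∀ l > L, circleCoeff h l = 0) (i : ℕ) : ∀ l > L + i,
      circleCoeff (fun θ => (Real.cos θ : ℂ) ^ i * h θ) l = 0 := by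
  induction i with
  | zero => simpa using h0
  | succ i ih =>
    intro l hl
    push_cast at hl
    have h1 := circleCoeff_cos_mul 1 (h := fun θ => (Real.cos θ : ℂ) ^ i * h θ) (by fun_prop) l
    rw [ih _ (by omega), ih _ (by omega)] at h1
    simp only [Int.cast_one, one_mul, ← mul_assoc, ← pow_succ'] at h1
    simpa using h1

theorem circleCoeff_eval_cos_mul (P : ℂ[X]) {h : ℝ → ℂ} (hh : Continuous h) (l : ℤ) :
    circleCoeff (fun θ => P.eval (Real.cos θ : ℂ) * h θ) l = ∑ i ∈ Finset.range (P.natDegree + 1),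
      P.coeff i * circleCoeff (fun θ => (Real.cos θ : ℂ) ^ i * h θ) l := by
  simp only [eval_eq_sum_range, Finset.sum_mul, mul_assoc]
  rw [circleCoeff_sum _ fun i _ => by fun_prop]
  simp only [circleCoeff_const_mul]

theorem circleCoeff_eval_cos_eq_zero (P : ℂ[X]) {l : ℤ} (hl : (P.natDegree : ℤ) < l) :
    circleCoeff (fun θ => P.eval (Real.cos θ : ℂ)) l = 0 := by
  have h1 := circleCoeff_eval_cos_mul P (h := fun _ => 1) continuous_const l
  simp only [mul_one] at h1
  rw [h1]
  refine Finset.sum_eq_zero fun i hi => ?_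
  have hi' : i ≤ P.natDegree := by simpa [Nat.lt_succ_iff] using hi
  have h2 := circleCoeff_cos_pow_mul_eq_zero (h := fun _ => 1) (L := 0) continuous_const
    (fun l hl => by rw [circleCoeff_one, if_neg (by omega)]) i l (by omega)
  simp only [mul_one] at h2
  rw [h2, mul_zero]

/-- Multiplication by $\cos\theta$ averages the two neighbouring coefficients, so the edge of the
gap moves inwards by one and its value is halved. The bound $i<N$ keeps the edges near $N$ and $-N$
from meeting. -/
theorem circleCoeff_cos_pow_mul_of_gap {h : ℝ → ℂ} (hh : Continuous h) {N : ℤ}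
    (h0 : ∀ l, |l| < N → circleCoeff h l = 0) (i : ℕ) (hi : i < N) :
    (∀ l, |l| < N - i → circleCoeff (fun θ => (Real.cos θ : ℂ) ^ i * h θ) l = 0) ∧
      circleCoeff (fun θ => (Real.cos θ : ℂ) ^ i * h θ) (N - i) = circleCoeff h N / 2 ^ i := by
  induction i with
  | zero => simpa using h0
  | succ i ih =>
    rw [Nat.cast_succ] at hi ⊢
    obtain ⟨ih1, ih2⟩ := ih (by omega)
    have h1 := circleCoeff_cos_mul 1 (h := fun θ => (Real.cos θ : ℂ) ^ i * h θ) (by fun_prop)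
    simp only [Int.cast_one, one_mul, ← mul_assoc, ← pow_succ'] at h1
    constructor
    · intro l hl
      rw [h1, ih1, ih1]
      · simp
      · rw [abs_lt] at hl ⊢
        omega
      · rw [abs_lt] at hl ⊢
        omega
    · rw [h1, ih1, show N - (i + 1) + 1 = N - i by ring, ih2]
      · rw [pow_succ]
        ring
      · rw [abs_lt]
        omega

/-- Only the leading term of $Q$ reaches the index $N-\deg Q$. This detects nonlinear approximations
that are not linear. -/
theorem circleCoeff_eval_cos_mul_of_gap {h : ℝ → ℂ} (hh : Continuous h) {N : ℤ}
    (h0 : ∀ l, |l| < N → circleCoeff h l = 0) (Q : ℂ[X]) (hQ : Q.natDegree < N) :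
    circleCoeff (fun θ => Q.eval (Real.cos θ : ℂ) * h θ) (N - Q.natDegree) =
      Q.leadingCoeff * (circleCoeff h N / 2 ^ Q.natDegree) := by
  rw [circleCoeff_eval_cos_mul Q hh, Finset.sum_eq_single Q.natDegree,
    (circleCoeff_cos_pow_mul_of_gap hh h0 _ hQ).2]
  · rfl
  · intro i hi hne
    have hi' : i < Q.natDegree := by
      have := Finset.mem_range.1 hi
      omega
    rw [(circleCoeff_cos_pow_mul_of_gap hh h0 i (by omega)).1, mul_zero]
    rw [abs_lt]
    omega
  · simp

theorem circleCoeff_eval_exp_mul (q : ℂ[X]) {h : ℝ → ℂ} (hh : Continuous h) (l : ℤ) :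
    circleCoeff (fun θ => q.eval (Complex.exp (θ * Complex.I)) * h θ) l =
      ∑ i ∈ Finset.range (q.natDegree + 1), q.coeff i * circleCoeff h (l - i) := by
  simp only [eval_eq_sum_range, Finset.sum_mul, mul_assoc]
  rw [circleCoeff_sum _ fun i _ => by fun_prop]
  refine Finset.sum_congr rfl fun i _ => ?_
  rw [circleCoeff_const_mul]
  congr 1
  rw [← circleCoeff_exp_mul i h l]
  congr 1
  ext θ
  rw [← Complex.exp_nat_mul]
  push_cast
  ring_nf

/-- Above $L$ the coefficients satisfy $h_l=w^{-1}h_{l+1}$, so $h_l=w^{-r}h_{l+r}$ for all $r$.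
Fourier coefficients are bounded and $|w|>1$, which forces zero. -/
theorem circleCoeff_eq_zero_of_one_sub {w : ℂ} (hw : 1 < ‖w‖) {h : ℝ → ℂ} (hh : Continuous h)
    {L : ℤ} (h0 : ∀ l > L, circleCoeff
      (fun θ => (1 - w⁻¹ * Complex.exp (-(θ * Complex.I))) * h θ) l = 0) :
    ∀ l > L, circleCoeff h l = 0 := by
  obtain ⟨K, hK⟩ := exists_norm_circleCoeff_le h
  have h1 : ∀ l > L, circleCoeff h l = w⁻¹ * circleCoeff h (l + 1) := by
    intro l hl
    have h2 : ∀ θ : ℝ, (1 - w⁻¹ * Complex.exp (-(θ * Complex.I))) * h θ =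
        h θ + -w⁻¹ * (Complex.exp ((-1 : ℤ) * θ * Complex.I) * h θ) := by
      intro θ
      push_cast
      ring_nf
    have h3 := h0 l hl
    simp only [h2] at h3
    rw [circleCoeff_add hh (by fun_prop), circleCoeff_const_mul, circleCoeff_exp_mul,
      sub_neg_eq_add] at h3
    linear_combination h3
  have h4 : ∀ r : ℕ, ∀ l > L, circleCoeff h l = w⁻¹ ^ r * circleCoeff h (l + r) := by
    intro r
    induction r with
    | zero => simp
    | succ r ih =>
      intro l hl
      rw [ih l hl, h1 (l + r) (by omega)]
      push_cast
      rw [pow_succ]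
      ring_nf
  intro l hl
  have h5 : Filter.Tendsto (fun r : ℕ => ‖w⁻¹‖ ^ r * K) Filter.atTop (nhds 0) := by
    have h6 := (tendsto_pow_atTop_nhds_zero_of_lt_one (norm_nonneg w⁻¹)
      (by rw [norm_inv]; exact inv_lt_one_of_one_lt₀ hw)).mul_const K
    rwa [zero_mul] at h6
  refine norm_le_zero_iff.1 (ge_of_tendsto' h5 fun r => ?_)
  rw [h4 r l hl, norm_mul, norm_pow]
  gcongr
  exact hK _

/-- `∏ (1 - z / w)` over a multiset. -/
def invRootsPoly (s : Multiset ℂ) : ℂ[X] := (s.map fun w => 1 - C w⁻¹ * X).prod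

theorem invRootsPoly_cons (w : ℂ) (s : Multiset ℂ) :
    invRootsPoly (w ::ₘ s) = (1 - C w⁻¹ * X) * invRootsPoly s := by
  simp [invRootsPoly]

theorem circleCoeff_eq_zero_of_invRootsPoly (s : Multiset ℂ) (hs : ∀ w ∈ s, 1 < ‖w‖) {L : ℤ} :
    ∀ {h : ℝ → ℂ}, Continuous h → (∀ l > L, circleCoeff
      (fun θ => (invRootsPoly s).eval (Complex.exp (-(θ * Complex.I))) * h θ) l = 0) →
    ∀ l > L, circleCoeff h l = 0 := by
  induction s using Multiset.induction_on with
  | empty =>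
    intro h _ h0
    simpa [invRootsPoly] using h0
  | cons w s ih =>
    intro h hh h0
    refine ih (fun v hv => hs v (Multiset.mem_cons_of_mem hv)) hh
      (circleCoeff_eq_zero_of_one_sub (hs w (Multiset.mem_cons_self w s)) (by fun_prop) ?_)
    simpa [invRootsPoly_cons, mul_assoc] using h0

/-! ### Factorization on the unit circle -/

/-- Joukowski map: the two solutions $\xi\pm\sqrt{\xi^2-1}$ are mutually inverse, and they lie on
the unit circle only for $\xi\in[-1,1]$. -/
theorem exists_add_inv_eq {ξ : ℂ} (hξ : ∀ x ∈ Set.Icc (-1 : ℝ) 1, (x : ℂ) ≠ ξ) :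
    ∃ w : ℂ, 1 < ‖w‖ ∧ w + w⁻¹ = 2 * ξ := by
  obtain ⟨s, hs⟩ := IsAlgClosed.exists_pow_nat_eq (ξ ^ 2 - 1) (n := 2) (by norm_num)
  have h1 : (ξ + s) * (ξ - s) = 1 := by linear_combination -hs
  have h2 : (ξ + s)⁻¹ = ξ - s := inv_eq_of_mul_eq_one_right h1
  have h3 : (ξ - s)⁻¹ = ξ + s := by rw [← h2, inv_inv]
  rcases lt_trichotomy 1 ‖ξ + s‖ with h | h | h
  · exact ⟨ξ + s, h, by rw [h2]; ring⟩
  · exfalso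
    refine hξ (ξ + s).re (abs_le.1 ((Complex.abs_re_le_norm _).trans h.ge)) ?_
    have h4 : (ξ + s)⁻¹ = starRingEnd ℂ (ξ + s) := Complex.inv_eq_conj h.symm
    rw [h2] at h4
    rw [Complex.re_eq_add_conj, ← h4]
    ring
  · refine ⟨ξ - s, ?_, by rw [h3]; ring⟩
    have h5 : ‖ξ + s‖ * ‖ξ - s‖ = 1 := by rw [← norm_mul, h1, norm_one]
    by_contra! h6
    nlinarith [norm_nonneg (ξ + s), norm_nonneg (ξ - s)]

theorem eval_zero_invRootsPoly (s : Multiset ℂ) : (invRootsPoly s).eval 0 = 1 := by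
  induction s using Multiset.induction_on with
  | empty => simp [invRootsPoly]
  | cons w s ih => simp [invRootsPoly_cons, ih]

theorem natDegree_invRootsPoly_le (s : Multiset ℂ) :
    (invRootsPoly s).natDegree ≤ Multiset.card s := by
  induction s using Multiset.induction_on with
  | empty => simp [invRootsPoly]
  | cons w s ih =>
    rw [invRootsPoly_cons, Multiset.card_cons, add_comm]
    exact natDegree_mul_le_of_le (by compute_degree) ih

/-- With $w+w^{-1}=2\xi$ each linear factor splits as $\cos\theta-\xi=-\frac w2(1-z/w)(1-z^{-1}/w)$.
-/
theorem exists_invRootsPoly_prod (r : Multiset ℂ)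
    (hr : ∀ ξ ∈ r, ∀ x ∈ Set.Icc (-1 : ℝ) 1, (x : ℂ) ≠ ξ) :
    ∃ s : Multiset ℂ, (∀ w ∈ s, 1 < ‖w‖) ∧ Multiset.card s = Multiset.card r ∧
      ∃ c : ℂ, c ≠ 0 ∧ ∀ θ : ℝ, (r.map fun ξ => X - C ξ).prod.eval (Real.cos θ : ℂ) =
        c * ((invRootsPoly s).eval (Complex.exp (θ * Complex.I)) *
          (invRootsPoly s).eval (Complex.exp (-(θ * Complex.I)))) := by
  induction r using Multiset.induction_on with
  | empty => exact ⟨0, by simp, by simp, 1, one_ne_zero, by simp [invRootsPoly]⟩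
  | cons ξ r ih =>
    obtain ⟨s, hs, hcard, c, hc, h⟩ := ih fun η hη => hr η (Multiset.mem_cons_of_mem hη)
    obtain ⟨w, hw, hwξ⟩ := exists_add_inv_eq (hr ξ (Multiset.mem_cons_self ξ r))
    have hw0 : w ≠ 0 := by
      rintro rfl
      simp at hw
      linarith
    refine ⟨w ::ₘ s, ?_, by simp [hcard], -(w / 2) * c, ?_, fun θ => ?_⟩
    · intro v hv
      rcases Multiset.mem_cons.1 hv with rfl | hv
      · exact hw
      · exact hs v hv
    · exact mul_ne_zero (neg_ne_zero.2 (div_ne_zero hw0 two_ne_zero)) hc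
    · rw [Multiset.map_cons, Multiset.prod_cons, eval_mul, h, invRootsPoly_cons]
      simp only [eval_mul, eval_sub, eval_X, eval_C, eval_one]
      have h1 : (Real.cos θ : ℂ) - ξ = -(w / 2) *
          ((1 - w⁻¹ * Complex.exp (θ * Complex.I)) * (1 - w⁻¹ * Complex.exp (-(θ * Complex.I)))) := by
        have h2 : Complex.exp (θ * Complex.I) * Complex.exp (-(θ * Complex.I)) = 1 := by
          rw [← Complex.exp_add, add_neg_cancel, Complex.exp_zero]
        have h3 : w * w⁻¹ = 1 := mul_inv_cancel₀ hw0
        rw [Complex.ofReal_cos, Complex.cos, neg_mul]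
        linear_combination (1 / 2 : ℂ) * hwξ + (w / 2 * w⁻¹ ^ 2) * h2 + (w⁻¹ / 2 -
          Complex.exp (θ * Complex.I) / 2 - Complex.exp (-(θ * Complex.I)) / 2) * h3
      rw [h1]
      ring

theorem exists_eval_cos_eq_invRootsPoly {Q : ℂ[X]}
    (hQ : ∀ x ∈ Set.Icc (-1 : ℝ) 1, Q.eval (x : ℂ) ≠ 0) :
    ∃ s : Multiset ℂ, (∀ w ∈ s, 1 < ‖w‖) ∧ (invRootsPoly s).natDegree ≤ Q.natDegree ∧
      ∃ c : ℂ, c ≠ 0 ∧ ∀ θ : ℝ, Q.eval (Real.cos θ : ℂ) =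
        c * ((invRootsPoly s).eval (Complex.exp (θ * Complex.I)) *
          (invRootsPoly s).eval (Complex.exp (-(θ * Complex.I)))) := by
  have hQ0 : Q ≠ 0 := by
    rintro rfl
    exact hQ 0 (by norm_num) (by simp)
  obtain ⟨s, hs, hcard, c, hc, h⟩ := exists_invRootsPoly_prod Q.roots fun ξ hξ x hx hxξ =>
    hQ x hx (by rw [hxξ]; exact isRoot_of_mem_roots hξ)
  refine ⟨s, hs, (natDegree_invRootsPoly_le s).trans (hcard.trans_le (card_roots' Q)),
    Q.leadingCoeff * c, mul_ne_zero (leadingCoeff_ne_zero.2 hQ0) hc, fun θ => ?_⟩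
  conv_lhs => rw [(IsAlgClosed.splits Q).eq_prod_roots]
  rw [eval_mul, eval_C, h, mul_assoc]

/-! ### Absolutely summable power series -/

/-- The sum of a power series on the closed unit disc. -/
def discEval (f : PowerSeries ℂ) (z : ℂ) : ℂ := ∑' l, PowerSeries.coeff l f * z ^ l

theorem norm_coeff_mul_pow_le (f : PowerSeries ℂ) {z : ℂ} (hz : ‖z‖ ≤ 1) (l : ℕ) :
    ‖PowerSeries.coeff l f * z ^ l‖ ≤ ‖PowerSeries.coeff l f‖ := by
  rw [norm_mul, norm_pow]
  exact mul_le_of_le_one_right (norm_nonneg _) (pow_le_one₀ (norm_nonneg _) hz)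

theorem hasSum_discEval {f : PowerSeries ℂ} (hf : Summable fun l => ‖PowerSeries.coeff l f‖)
    {z : ℂ} (hz : ‖z‖ ≤ 1) : HasSum (fun l => PowerSeries.coeff l f * z ^ l) (discEval f z) :=
  (Summable.of_norm_bounded hf (norm_coeff_mul_pow_le f hz)).hasSum

theorem summable_norm_coeff_mul {f g : PowerSeries ℂ}
    (hf : Summable fun l => ‖PowerSeries.coeff l f‖)
    (hg : Summable fun l => ‖PowerSeries.coeff l g‖) :
    Summable fun l => ‖PowerSeries.coeff l (f * g)‖ := by
  simp only [PowerSeries.coeff_mul]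
  exact summable_norm_sum_mul_antidiagonal_of_summable_norm
    (f := fun l => PowerSeries.coeff l f) (g := fun l => PowerSeries.coeff l g) hf hg

theorem discEval_mul {f g : PowerSeries ℂ} (hf : Summable fun l => ‖PowerSeries.coeff l f‖)
    (hg : Summable fun l => ‖PowerSeries.coeff l g‖) {z : ℂ} (hz : ‖z‖ ≤ 1) :
    discEval (f * g) z = discEval f z * discEval g z := by
  have hf' := hf.of_nonneg_of_le (fun _ => norm_nonneg _) (norm_coeff_mul_pow_le f hz)
  have hg' := hg.of_nonneg_of_le (fun _ => norm_nonneg _) (norm_coeff_mul_pow_le g hz)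
  rw [discEval, discEval, discEval,
    tsum_mul_tsum_eq_tsum_sum_antidiagonal_of_summable_norm hf' hg']
  refine tsum_congr fun l => ?_
  rw [PowerSeries.coeff_mul, Finset.sum_mul]
  refine Finset.sum_congr rfl fun p hp => ?_
  rw [← Finset.HasAntidiagonal.mem_antidiagonal.1 hp, pow_add]
  ring

theorem summable_norm_coeff_sub {f g : PowerSeries ℂ}
    (hf : Summable fun l => ‖PowerSeries.coeff l f‖)
    (hg : Summable fun l => ‖PowerSeries.coeff l g‖) :
    Summable fun l => ‖PowerSeries.coeff l (f - g)‖ := by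
  simp only [map_sub]
  exact (hf.add hg).of_nonneg_of_le (fun _ => norm_nonneg _) fun l => norm_sub_le _ _

theorem discEval_sub {f g : PowerSeries ℂ} (hf : Summable fun l => ‖PowerSeries.coeff l f‖)
    (hg : Summable fun l => ‖PowerSeries.coeff l g‖) {z : ℂ} (hz : ‖z‖ ≤ 1) :
    discEval (f - g) z = discEval f z - discEval g z := by
  have h := (hasSum_discEval hf hz).sub (hasSum_discEval hg hz)
  simp only [← sub_mul, ← map_sub] at h
  exact h.tsum_eq

theorem summable_norm_coeff_coe (Q : ℂ[X]) :
    Summable fun l => ‖PowerSeries.coeff l (Q : PowerSeries ℂ)‖ := by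
  refine summable_of_ne_finset_zero (s := Finset.range (Q.natDegree + 1)) fun l hl => ?_
  rw [coeff_coe, coeff_eq_zero_of_natDegree_lt (by simpa [Nat.lt_succ_iff] using hl), norm_zero]

theorem discEval_coe (Q : ℂ[X]) (z : ℂ) : discEval (Q : PowerSeries ℂ) z = Q.eval z := by
  rw [discEval, eval_eq_sum_range]
  simp only [coeff_coe]
  refine tsum_eq_sum fun l hl => ?_
  rw [coeff_eq_zero_of_natDegree_lt (by simpa [Nat.lt_succ_iff] using hl), zero_mul]

theorem exists_summable_inverse_of_one_lt {w : ℂ} (hw : 1 < ‖w‖) :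
    ∃ g : PowerSeries ℂ, (Summable fun l => ‖PowerSeries.coeff l g‖) ∧
      ((X - C w : ℂ[X]) : PowerSeries ℂ) * g = 1 := by
  have hw0 : w ≠ 0 := by
    rintro rfl
    simp at hw
    linarith
  refine ⟨PowerSeries.mk fun l => -w⁻¹ ^ (l + 1), ?_, ?_⟩
  · simp only [PowerSeries.coeff_mk, norm_neg, norm_pow]
    simp only [pow_succ]
    refine (summable_geometric_of_lt_one (norm_nonneg w⁻¹) ?_).mul_right _
    rw [norm_inv]
    exact inv_lt_one_of_one_lt₀ hw
  · ext l
    rw [Polynomial.coe_sub, Polynomial.coe_X, Polynomial.coe_C, sub_mul, map_sub,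
      PowerSeries.coeff_C_mul, PowerSeries.coeff_mk, PowerSeries.coeff_one]
    cases l with
    | zero => simp [hw0]
    | succ l =>
      rw [PowerSeries.coeff_succ_X_mul, PowerSeries.coeff_mk, if_neg (by omega), pow_succ w⁻¹ (l + 1)]
      field_simp
      ring

theorem exists_summable_inverse_prod (r : Multiset ℂ) (hr : ∀ w ∈ r, 1 < ‖w‖) :
    ∃ g : PowerSeries ℂ, (Summable fun l => ‖PowerSeries.coeff l g‖) ∧
      (((r.map fun w => X - C w).prod : ℂ[X]) : PowerSeries ℂ) * g = 1 := by
  induction r using Multiset.induction_on with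
  | empty => exact ⟨((1 : ℂ[X]) : PowerSeries ℂ), summable_norm_coeff_coe 1, by simp⟩
  | cons w r ih =>
    obtain ⟨g, hg, h⟩ := ih fun v hv => hr v (Multiset.mem_cons_of_mem hv)
    obtain ⟨g', hg', h'⟩ := exists_summable_inverse_of_one_lt (hr w (Multiset.mem_cons_self w r))
    refine ⟨g' * g, summable_norm_coeff_mul hg' hg, ?_⟩
    rw [Multiset.map_cons, Multiset.prod_cons, Polynomial.coe_mul, mul_mul_mul_comm, h, h', one_mul]

/-- A product of geometric series. Absolute summability of $1/Q$ lets the remainder be evaluated on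
the circle itself and read as a Chebyshev series. -/
theorem exists_summable_inverse {Q : ℂ[X]} (hQ : ∀ z : ℂ, ‖z‖ ≤ 1 → Q.eval z ≠ 0) :
    ∃ g : PowerSeries ℂ, (Summable fun l => ‖PowerSeries.coeff l g‖) ∧
      (Q : PowerSeries ℂ) * g = 1 := by
  have hQ0 : Q ≠ 0 := by
    rintro rfl
    exact hQ 0 (by simp) (by simp)
  obtain ⟨g, hg, h⟩ := exists_summable_inverse_prod Q.roots fun w hw => by
    by_contra! hw1
    exact hQ w hw1 (isRoot_of_mem_roots hw)
  refine ⟨((C Q.leadingCoeff⁻¹ : ℂ[X]) : PowerSeries ℂ) * g,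
    summable_norm_coeff_mul (summable_norm_coeff_coe _) hg, ?_⟩
  conv_lhs => enter [1, 1]; rw [(IsAlgClosed.splits Q).eq_prod_roots]
  rw [Polynomial.coe_mul, mul_mul_mul_comm, h, mul_one, ← Polynomial.coe_mul, ← C_mul,
    mul_inv_cancel₀ (leadingCoeff_ne_zero.2 hQ0)]
  simp

/-! ### Existence -/

/-- The polynomial in `x = cos θ` equal to the mean of `A(z) B(1/z)` and `A(1/z) B(z)` at
`z = e^{iθ}`. -/
def circleProd (A B : ℂ[X]) : ℂ[X] :=
  ∑ i ∈ Finset.range (A.natDegree + 1), ∑ j ∈ Finset.range (B.natDegree + 1),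
    C (A.coeff i * B.coeff j) * Polynomial.Chebyshev.T ℂ ((i : ℤ) - j)

theorem natDegree_circleProd_le {A B : ℂ[X]} {d : ℕ} (hA : A.natDegree ≤ d)
    (hB : B.natDegree ≤ d) : (circleProd A B).natDegree ≤ d := by
  refine natDegree_sum_le_of_forall_le _ _ fun i hi => natDegree_sum_le_of_forall_le _ _
    fun j hj => (natDegree_C_mul_le _ _).trans ?_
  rw [Polynomial.Chebyshev.natDegree_T]
  simp only [Finset.mem_range] at hi hj
  omega

theorem eval_circleProd (A B : ℂ[X]) (θ : ℝ) : (circleProd A B).eval (Real.cos θ : ℂ) =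
    (A.eval (Complex.exp (θ * Complex.I)) * B.eval (Complex.exp (-(θ * Complex.I))) +
      A.eval (Complex.exp (-(θ * Complex.I))) * B.eval (Complex.exp (θ * Complex.I))) / 2 := by
  simp only [circleProd, eval_finsetSum, eval_mul, eval_C, Complex.ofReal_cos,
    Polynomial.Chebyshev.T_complex_cos]
  simp only [eval_eq_sum_range, Finset.sum_mul_sum, ← Finset.sum_add_distrib, Finset.sum_div]
  refine Finset.sum_congr rfl fun i _ => Finset.sum_congr rfl fun j _ => ?_
  simp only [← Complex.exp_nat_mul]
  rw [Complex.cos]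
  have h1 : Complex.exp (((i : ℤ) - j : ℤ) * θ * Complex.I) =
      Complex.exp (i * (θ * Complex.I)) * Complex.exp (j * -(θ * Complex.I)) := by
    rw [← Complex.exp_add]
    congr 1
    push_cast
    ring
  have h2 : Complex.exp (-(((i : ℤ) - j : ℤ) * θ) * Complex.I) =
      Complex.exp (i * -(θ * Complex.I)) * Complex.exp (j * (θ * Complex.I)) := by
    rw [← Complex.exp_add]
    congr 1
    push_cast
    ring
  rw [h1, h2]
  ring

theorem hasSum_chebT_of_discEval {f : PowerSeries ℂ}
    (hf : Summable fun l => ‖PowerSeries.coeff l f‖) (θ : ℝ) :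
    HasSum (fun l => PowerSeries.coeff l f * (chebT l (Real.cos θ) : ℂ))
      ((discEval f (Complex.exp (θ * Complex.I)) +
        discEval f (Complex.exp (-(θ * Complex.I)))) / 2) := by
  have h1 : ‖Complex.exp (θ * Complex.I)‖ ≤ 1 := (Complex.norm_exp_ofReal_mul_I θ).le
  have h2 : ‖Complex.exp (-(θ * Complex.I))‖ ≤ 1 := by
    have := Complex.norm_exp_ofReal_mul_I (-θ)
    push_cast at this
    rw [neg_mul] at this
    exact this.le
  have h3 := ((hasSum_discEval hf h1).add (hasSum_discEval hf h2)).div_const 2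
  refine h3.congr_fun fun l => ?_
  rw [chebT_cos, Complex.ofReal_cos, Complex.cos, ← Complex.exp_nat_mul, ← Complex.exp_nat_mul]
  push_cast
  ring_nf

theorem summable_norm_coeff_mittagLefflerSeries {γ : ℝ} (hγ : ∀ p : ℕ, γ ≠ -(p : ℝ)) (a : ℝ) :
    Summable fun l => ‖PowerSeries.coeff l (mittagLefflerSeries γ a)‖ := by
  simp only [mittagLefflerSeries, PowerSeries.coeff_mk, Complex.norm_real]
  exact summable_norm_pow_div_poch hγ a

theorem hasSum_chebF {γ : ℝ} (hγ : ∀ p : ℕ, γ ≠ -(p : ℝ)) (a : ℝ) (θ : ℝ) :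
    HasSum (fun l => PowerSeries.coeff l (mittagLefflerSeries γ a) * (chebT l (Real.cos θ) : ℂ))
      (chebF γ a (Real.cos θ) : ℂ) := by
  have h := (hasSum_chebT_of_discEval (summable_norm_coeff_mittagLefflerSeries hγ a) θ).summable
  simp only [mittagLefflerSeries, PowerSeries.coeff_mk, ← Complex.ofReal_mul] at h ⊢
  rw [Complex.hasSum_ofReal]
  exact (Complex.summable_ofReal.1 h).hasSum

section

variable {k : ℕ} {γ : ℝ} {lam : Fin k → ℝ} {n : ℕ} {m : Fin k → ℕ}

/-- The remainder $R=(QE_j-P_j)/Q$ is $O(z^{n+d+1})$, and the mean of $R(z)$ and $R(1/z)$ has the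
Taylor coefficients of $R$ as Chebyshev coefficients. -/
theorem IsHermitePade.isNonlinearHermiteChebyshev (hγ : ∀ p : ℕ, γ ≠ -(p : ℝ))
    (hm : ∀ j, m j ≤ n) {Q : ℂ[X]} {P : Fin k → ℂ[X]}
    (h : IsHermitePade (fun j => mittagLefflerSeries γ (lam j)) n m Q P)
    (hQ : ∀ z : ℂ, ‖z‖ ≤ 1 → Q.eval z ≠ 0) :
    IsNonlinearHermiteChebyshev (fun j => chebF γ (lam j)) n m (circleProd Q Q)
      fun j => circleProd (P j) Q := by
  have hz1 : ∀ θ : ℝ, ‖Complex.exp (θ * Complex.I)‖ ≤ 1 := fun θ =>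
    (Complex.norm_exp_ofReal_mul_I θ).le
  have hz2 : ∀ θ : ℝ, ‖Complex.exp (-(θ * Complex.I))‖ ≤ 1 := fun θ => by
    have := Complex.norm_exp_ofReal_mul_I (-θ)
    push_cast at this
    rw [neg_mul] at this
    exact this.le
  refine ⟨fun x hx => ?_, natDegree_circleProd_le h.natDegree_denom h.natDegree_denom,
    fun j => natDegree_circleProd_le (h.natDegree_num j) (h.natDegree_denom.trans ?_),
    fun j => ?_⟩
  · rw [← Real.cos_arccos hx.1 hx.2, eval_circleProd]
    have h1 := mul_ne_zero (hQ _ (hz1 (Real.arccos x))) (hQ _ (hz2 (Real.arccos x)))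
    contrapose! h1
    linear_combination h1
  -- `circleProd (P j) Q` has degree at most the larger of the two degrees, and $d\le n_j$ because
  -- $m_j\le n$.
  · have := hm j
    omega
  · obtain ⟨g, hg, hgQ⟩ := exists_summable_inverse hQ
    have hE := summable_norm_coeff_mittagLefflerSeries hγ (lam j)
    have hs1 := summable_norm_coeff_mul (summable_norm_coeff_coe Q) hE
    have hs2 := summable_norm_coeff_sub hs1 (summable_norm_coeff_coe (P j))
    have hR := summable_norm_coeff_mul hg hs2
    set R := g * ((Q : PowerSeries ℂ) * mittagLefflerSeries γ (lam j) - P j) with hRdef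
    have hev : ∀ z : ℂ, ‖z‖ ≤ 1 → discEval R z =
        discEval (mittagLefflerSeries γ (lam j)) z - (P j).eval z / Q.eval z := by
      intro z hz
      have h1 : Q.eval z * discEval g z = 1 := by
        rw [← discEval_coe, ← discEval_mul (summable_norm_coeff_coe Q) hg hz, hgQ,
          ← Polynomial.coe_one, discEval_coe, eval_one]
      rw [hRdef, discEval_mul hg hs2 hz, discEval_sub hs1 (summable_norm_coeff_coe _) hz,
        discEval_mul (summable_norm_coeff_coe Q) hE hz, discEval_coe, discEval_coe,
        eq_inv_of_mul_eq_one_right h1]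
      have := hQ z hz
      field_simp
    refine ⟨fun l => PowerSeries.coeff l R, ?_, fun x hx => ?_⟩
    · refine PowerSeries.X_pow_dvd_iff.1 ?_
      exact (h.order j).mul_left g
    · rw [← Real.cos_arccos hx.1 hx.2]
      set θ := Real.arccos x
      have h1 := hasSum_chebT_of_discEval hR θ
      convert h1 using 1
      have h2 := (hasSum_chebF hγ (lam j) θ).unique (hasSum_chebT_of_discEval hE θ)
      simp only
      rw [h2, hev _ (hz1 θ), hev _ (hz2 θ), eval_circleProd, eval_circleProd]
      have h3 := hQ _ (hz1 θ)
      have h4 := hQ _ (hz2 θ)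
      field_simp
      ring

/-! ### Uniqueness -/

/-- $q(1/z)\cdot q(z)P/Q=P/c$ has no frequency above $d$, and the factor $q(1/z)$ can be removed by
`circleCoeff_eq_zero_of_invRootsPoly`. The frequencies $l>d$ of $q(z)P/Q$ are $\pi$ times the power
series coefficients of $q\sum D_lz^l$. -/
theorem coeff_invRootsPoly_mul_eq_zero {s : Multiset ℂ} (hs : ∀ w ∈ s, 1 < ‖w‖) {c : ℂ}
    (hc : c ≠ 0) {Q P : ℂ[X]} {d : ℕ} (hP : P.natDegree ≤ d) (hsd : (invRootsPoly s).natDegree ≤ d)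
    (hQ0 : ∀ x ∈ Set.Icc (-1 : ℝ) 1, Q.eval (x : ℂ) ≠ 0)
    (hQ : ∀ θ : ℝ, Q.eval (Real.cos θ : ℂ) =
        c * ((invRootsPoly s).eval (Complex.exp (θ * Complex.I)) *
          (invRootsPoly s).eval (Complex.exp (-(θ * Complex.I)))))
    {D : ℕ → ℂ} (hD : Summable fun l => ‖D l‖)
    (hsum : ∀ θ, HasSum (fun l => D l * (chebT l (Real.cos θ) : ℂ))
      (P.eval (Real.cos θ : ℂ) / Q.eval (Real.cos θ : ℂ))) {l : ℕ} (hl : d < l) :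
    PowerSeries.coeff l ((invRootsPoly s : PowerSeries ℂ) * PowerSeries.mk D) = 0 := by
  set q := invRootsPoly s
  have hcont := continuous_of_hasSum_chebT hD hsum
  set f := fun θ : ℝ => P.eval (Real.cos θ : ℂ) / Q.eval (Real.cos θ : ℂ) with hf
  have h1 := circleCoeff_eq_zero_of_invRootsPoly s hs (L := d)
    (h := fun θ => q.eval (Complex.exp (θ * Complex.I)) * f θ) (by fun_prop) (fun l hl => by
      have h2 : ∀ θ : ℝ, q.eval (Complex.exp (-(θ * Complex.I))) *
          (q.eval (Complex.exp (θ * Complex.I)) * f θ) = c⁻¹ * P.eval (Real.cos θ : ℂ) := by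
        intro θ
        have h3 := hQ0 _ ⟨Real.neg_one_le_cos θ, Real.cos_le_one θ⟩
        rw [hf]
        simp only
        rw [hQ θ] at h3 ⊢
        have h4 := right_ne_zero_of_mul (right_ne_zero_of_mul h3)
        have h5 := left_ne_zero_of_mul (right_ne_zero_of_mul h3)
        field_simp
      simp only [q] at h2
      simp only [q, h2]
      rw [circleCoeff_const_mul, circleCoeff_eval_cos_eq_zero _ (by omega), mul_zero])
  have h6 := h1 l (by omega)
  rw [circleCoeff_eval_exp_mul q hcont] at h6
  rw [coeff_coe_mul_of_le le_rfl (by omega), ← Finset.sum_range_reflect]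
  have h7 : ∀ i ∈ Finset.range (q.natDegree + 1), q.coeff i * circleCoeff f (l - i) =
      Real.pi * (q.coeff (q.natDegree - (q.natDegree + 1 - 1 - i)) * PowerSeries.coeff
        (l - q.natDegree + (q.natDegree + 1 - 1 - i)) (PowerSeries.mk D)) := by
    intro i hi
    have hi' : i ≤ q.natDegree := by simpa [Nat.lt_succ_iff] using hi
    -- As $i\le\deg q\le d<l$, the index $l-i$ is positive, so the exceptional constant term $2\pi
    -- D_0$ never enters.
    rw [show ((l : ℤ) - i) = ((l - i : ℕ) : ℤ) by omega,
      circleCoeff_eq_pi_mul hD hsum (by omega), PowerSeries.coeff_mk,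
      show q.natDegree - (q.natDegree + 1 - 1 - i) = i by omega,
      show l - q.natDegree + (q.natDegree + 1 - 1 - i) = l - i by omega]
    ring
  rw [Finset.sum_congr rfl h7, ← Finset.mul_sum] at h6
  exact (mul_eq_zero.1 h6).resolve_left (by exact_mod_cast Real.pi_ne_zero)

/-- Above $n_j$ the series $qE_j$ and $q\sum a_lz^l$ have equal coefficients, and the latter starts
at $n+d+1$. The last clause, on its first coefficient, serves the comparison with linear
approximations. -/
theorem IsNonlinearHermiteChebyshev.exists_invRootsPoly (hγ : ∀ p : ℕ, γ ≠ -(p : ℝ))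
    (hm : ∀ j, m j ≤ n) {Q : ℂ[X]} {P : Fin k → ℂ[X]}
    (h : IsNonlinearHermiteChebyshev (fun j => chebF γ (lam j)) n m Q P) :
    ∃ q : ℂ[X], q.eval 0 = 1 ∧ (∃ P', IsHermitePade (fun j => mittagLefflerSeries γ (lam j)) n m
      q P') ∧ (∃ c : ℂ, c ≠ 0 ∧ ∀ θ : ℝ, Q.eval (Real.cos θ : ℂ) =
        c * (q.eval (Complex.exp (θ * Complex.I)) * q.eval (Complex.exp (-(θ * Complex.I))))) ∧
      ∀ j, ∀ a : ℕ → ℂ, (∀ l < n + ∑ i, m i + 1, a l = 0) →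
        (∀ x ∈ Set.Icc (-1 : ℝ) 1, HasSum (fun l => a l * (chebT l x : ℂ))
          ((chebF γ (lam j) x : ℂ) - (P j).eval (x : ℂ) / Q.eval (x : ℂ))) →
        PowerSeries.coeff (n + ∑ i, m i + 1) ((q : PowerSeries ℂ) *
          mittagLefflerSeries γ (lam j)) = a (n + ∑ i, m i + 1) := by
  obtain ⟨s, hs, hdeg, c, hc, hQ⟩ := exists_eval_cos_eq_invRootsPoly h.eval_ne_zero
  have hq0 := eval_zero_invRootsPoly s
  have hqd : (invRootsPoly s).natDegree ≤ ∑ i, m i := hdeg.trans h.natDegree_denom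
  have key : ∀ j, ∀ a : ℕ → ℂ, (∀ x ∈ Set.Icc (-1 : ℝ) 1,
      HasSum (fun l => a l * (chebT l x : ℂ))
        ((chebF γ (lam j) x : ℂ) - (P j).eval (x : ℂ) / Q.eval (x : ℂ))) →
      ∀ l, n + ∑ i, m i - m j < l → PowerSeries.coeff l ((invRootsPoly s : PowerSeries ℂ) *
        mittagLefflerSeries γ (lam j)) =
        PowerSeries.coeff l ((invRootsPoly s : PowerSeries ℂ) * PowerSeries.mk a) := by
    intro j a ha l hl
    have hj := hm j
    have hE := summable_norm_coeff_mittagLefflerSeries hγ (lam j)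
    have ha1 := summable_norm_of_hasSum_chebT (ha 1 (by norm_num))
    have h1 := coeff_invRootsPoly_mul_eq_zero hs hc (h.natDegree_num j)
      (hqd.trans (by omega)) h.eval_ne_zero hQ
      (D := fun l => PowerSeries.coeff l (mittagLefflerSeries γ (lam j)) - a l)
      ((hE.add ha1).of_nonneg_of_le (fun _ => norm_nonneg _) fun l => norm_sub_le _ _)
      (fun θ => by
        have h2 := (hasSum_chebF hγ (lam j) θ).sub
          (ha _ ⟨Real.neg_one_le_cos θ, Real.cos_le_one θ⟩)
        simp only [← sub_mul] at h2
        rwa [sub_sub_cancel] at h2) hl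
    have h3 : (PowerSeries.mk fun l => PowerSeries.coeff l (mittagLefflerSeries γ (lam j)) - a l) =
        mittagLefflerSeries γ (lam j) - PowerSeries.mk a := by
      ext l
      simp
    rw [h3, mul_sub, map_sub] at h1
    exact sub_eq_zero.1 h1
  have hdvd : ∀ a : ℕ → ℂ, (∀ l < n + ∑ i, m i + 1, a l = 0) →
      ∀ l < n + ∑ i, m i + 1, PowerSeries.coeff l
        ((invRootsPoly s : PowerSeries ℂ) * PowerSeries.mk a) = 0 := fun a ha =>
    PowerSeries.X_pow_dvd_iff.1 ((PowerSeries.X_pow_dvd_iff.2 fun l hl => by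
      rw [PowerSeries.coeff_mk, ha l hl]).mul_left _)
  refine ⟨invRootsPoly s, hq0, ⟨_, isHermitePade_of_coeff ?_ hqd fun j l hl hl' => ?_⟩,
    ⟨c, hc, hQ⟩, fun j a ha0 ha => ?_⟩
  · intro h0
    rw [h0] at hq0
    simp at hq0
  · obtain ⟨a, ha0, ha⟩ := h.remainder j
    rw [key j a ha l hl, hdvd a ha0 l (by omega)]
  · rw [key j a ha _ (by omega), PowerSeries.coeff_mul, Finset.sum_eq_single (0, n + ∑ i, m i + 1)]
    · rw [coeff_coe, coeff_zero_eq_eval_zero, hq0, one_mul, PowerSeries.coeff_mk]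
    · rintro ⟨i, l⟩ hil hne
      rw [Finset.HasAntidiagonal.mem_antidiagonal] at hil
      simp only at hil ⊢
      have : i ≠ 0 := by
        rintro rfl
        exact hne (by simp at hil ⊢; omega)
      rw [PowerSeries.coeff_mk, ha0 l (by omega), mul_zero]
    · intro hn
      simp at hn

end

/-! ### The Laplace integral -/

theorem integrableOn_rpow_mul_cexp {a : ℝ} (ha : 0 < a) {z : ℂ} (hz : 0 < z.re) :
    MeasureTheory.IntegrableOn (fun t : ℝ => ((t ^ (a - 1) : ℝ) : ℂ) * Complex.exp (-z * t))
      (Set.Ioi 0) := by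
  have h1 := integrableOn_rpow_mul_exp_neg_mul_rpow (s := a - 1) (by linarith) one_pos hz
  simp only [Real.rpow_one] at h1
  refine MeasureTheory.Integrable.mono' h1 ?_ ?_
  · refine (Measurable.aestronglyMeasurable ?_)
    fun_prop
  · refine (MeasureTheory.ae_restrict_iff' measurableSet_Ioi).2 (Filter.Eventually.of_forall ?_)
    intro t ht
    rw [norm_mul, Complex.norm_real, Complex.norm_exp,
      Real.norm_of_nonneg (Real.rpow_nonneg (le_of_lt ht) _)]
    simp

theorem differentiableAt_laplace_rpow {a : ℝ} (ha : 0 < a) {z : ℂ} (hz : 0 < z.re) :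
    DifferentiableAt ℂ (fun z : ℂ => ∫ t in Set.Ioi (0 : ℝ),
      ((t ^ (a - 1) : ℝ) : ℂ) * Complex.exp (-z * t)) z := by
  have hb : 0 < z.re / 2 := by positivity
  have h1 := integrableOn_rpow_mul_exp_neg_mul_rpow (s := a) (by linarith) one_pos hb
  simp only [Real.rpow_one] at h1
  have hS : {w : ℂ | z.re / 2 < w.re} ∈ nhds z :=
    (isOpen_lt continuous_const Complex.continuous_re).mem_nhds (by
      change z.re / 2 < z.re
      linarith)
  refine (hasDerivAt_integral_of_dominated_loc_of_deriv_le
    (μ := MeasureTheory.volume.restrict (Set.Ioi (0 : ℝ)))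
    (F := fun (z : ℂ) (t : ℝ) => ((t ^ (a - 1) : ℝ) : ℂ) * Complex.exp (-z * t))
    (F' := fun (z : ℂ) (t : ℝ) => ((t ^ (a - 1) : ℝ) : ℂ) * (Complex.exp (-z * t) * -t))
    (bound := fun t => t ^ a * Real.exp (-(z.re / 2) * t)) hS
    (Filter.Eventually.of_forall fun w => Measurable.aestronglyMeasurable (by fun_prop))
    (integrableOn_rpow_mul_cexp ha hz) (Measurable.aestronglyMeasurable (by fun_prop)) ?_ h1
    ?_).2.differentiableAt
  · refine (MeasureTheory.ae_restrict_iff' measurableSet_Ioi).2 (Filter.Eventually.of_forall ?_)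
    intro t ht w hw
    have ht' : 0 < t := ht
    have h2 : t ^ a = t ^ (a - 1) * t := by
      rw [← Real.rpow_add_one ht'.ne', sub_add_cancel]
    rw [norm_mul, norm_mul, norm_neg, Complex.norm_real, Complex.norm_real, Complex.norm_exp,
      Real.norm_of_nonneg (Real.rpow_nonneg ht'.le _), Real.norm_of_nonneg ht'.le, h2,
      mul_assoc, mul_comm t]
    gcongr
    have hw' : z.re / 2 < w.re := hw
    simp
    gcongr
  · refine Filter.Eventually.of_forall fun t w _ => ?_
    have h3 : HasDerivAt (fun w : ℂ => -w * (t : ℂ)) (-(t : ℂ)) w := by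
      simpa using (hasDerivAt_id w).neg.mul_const (t : ℂ)
    exact h3.cexp.const_mul _

/-- Both sides are analytic in the right half-plane and agree for real $z>0$, so the identity
theorem applies. -/
theorem integral_rpow_mul_cexp {a : ℝ} (ha : 0 < a) {z : ℂ} (hz : 0 < z.re) :
    ∫ t in Set.Ioi (0 : ℝ), ((t ^ (a - 1) : ℝ) : ℂ) * Complex.exp (-z * t) =
      Real.Gamma a * Complex.exp (-a * Complex.log z) := by
  set S := {z : ℂ | 0 < z.re} with hS
  have hSo : IsOpen S := isOpen_lt continuous_const Complex.continuous_re
  have hf : AnalyticOnNhd ℂ (fun z : ℂ => ∫ t in Set.Ioi (0 : ℝ),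
      ((t ^ (a - 1) : ℝ) : ℂ) * Complex.exp (-z * t)) S :=
    DifferentiableOn.analyticOnNhd (fun w hw =>
      (differentiableAt_laplace_rpow ha hw).differentiableWithinAt) hSo
  have hg : AnalyticOnNhd ℂ (fun z : ℂ => (Real.Gamma a : ℂ) *
      Complex.exp (-a * Complex.log z)) S :=
    DifferentiableOn.analyticOnNhd (fun w hw => by
      have h1 : w ∈ Complex.slitPlane := Or.inl hw
      exact (((Complex.differentiableAt_log h1).const_mul _).cexp.const_mul
        _).differentiableWithinAt) hSo
  have hconv : IsPreconnected S := (convex_halfSpace_re_gt 0).isPreconnected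
  refine hf.eqOn_of_preconnected_of_frequently_eq hg hconv (z₀ := 1) (by simp [hS]) ?_ hz
  have h2 : Filter.Tendsto (fun x : ℝ => (x : ℂ)) (nhdsWithin 1 {1}ᶜ) (nhdsWithin 1 {1}ᶜ) := by
    refine tendsto_nhdsWithin_iff.2 ⟨?_, ?_⟩
    · exact (Complex.continuous_ofReal.tendsto' 1 1 (by simp)).mono_left nhdsWithin_le_nhds
    · filter_upwards [self_mem_nhdsWithin] with x hx
      simpa using hx
  refine h2.frequently (Filter.Eventually.frequently ?_)
  filter_upwards [nhdsWithin_le_nhds (lt_mem_nhds (zero_lt_one' ℝ))] with x hx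
  have h3 := Real.integral_rpow_mul_exp_neg_mul_Ioi ha hx
  have h4 : ∀ t : ℝ, ((t ^ (a - 1) : ℝ) : ℂ) * Complex.exp (-(x : ℂ) * t) =
      ((t ^ (a - 1) * Real.exp (-(x * t)) : ℝ) : ℂ) := by
    intro t
    push_cast
    rw [neg_mul]
  simp only [h4]
  rw [integral_complex_ofReal, h3, ← Complex.ofReal_log hx.le, one_div, Real.inv_rpow hx.le,
    ← Real.rpow_neg hx.le, Real.rpow_def_of_pos hx]
  push_cast
  rw [mul_comm, mul_comm (Complex.ofReal (Real.log x))]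

section

variable {k : ℕ} {γ : ℝ} {lam : Fin k → ℝ} {n : ℕ} {m : Fin k → ℕ}

theorem weightU_eq_sum {t : ℝ} (ht : 0 < t) : weightU γ lam n m t =
    ∑ r ∈ Finset.range (∑ i, m i + 1), (nodePoly lam m).coeff r * t ^ ((n : ℝ) + r + γ - 1) := by
  have h1 : ∏ p, (t - lam p) ^ m p = (nodePoly lam m).eval t := by
    rw [nodePoly, eval_prod]
    simp
  rw [weightU, h1, eval_eq_sum_range' (Nat.lt_succ_of_le (natDegree_nodePoly lam m).le),
    Finset.mul_sum]
  refine Finset.sum_congr rfl fun r _ => ?_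
  rw [show (n : ℝ) + r + γ - 1 = n + γ - 1 + r by ring, Real.rpow_add_natCast ht.ne']
  ring

theorem Gamma_add_natCast (hγ : ∀ p : ℕ, γ ≠ -(p : ℝ)) (p : ℕ) :
    Real.Gamma (γ + p) = poch γ p * Real.Gamma γ := by
  induction p with
  | zero => simp [poch_zero]
  | succ p ih =>
    have h : γ + p ≠ 0 := fun h => hγ p (by linarith)
    rw [Nat.cast_succ, ← add_assoc, Real.Gamma_add_one h, ih, poch_succ]
    ring

/-- The analytic continuation of the Laplace integral to the plane cut along `{-iy : y ≥ 0}`. -/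
def laplaceContinuation (γ : ℝ) (lam : Fin k → ℝ) (n : ℕ) (m : Fin k → ℕ) (z : ℂ) : ℂ :=
  Real.Gamma ((n : ℝ) + (∑ i, m i : ℕ) + γ) *
    ((padeDenom γ lam n m).map Complex.ofRealHom).eval z *
    Complex.exp (-(((n : ℝ) + (∑ i, m i : ℕ) + γ : ℝ) : ℂ) *
      (Complex.log (-Complex.I * z) + Real.pi / 2 * Complex.I))

/-- The left side is the branch of the logarithm cut along $\{-iy:y\ge0\}$; it agrees with the
principal one where the integral converges. -/
theorem log_neg_I_mul {z : ℂ} (hz : 0 < z.re) :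
    Complex.log (-Complex.I * z) + Real.pi / 2 * Complex.I = Complex.log z := by
  have hz0 : z ≠ 0 := by
    rintro rfl
    simp at hz
  have h1 : |z.arg| < Real.pi / 2 := Complex.abs_arg_lt_pi_div_two_iff.2 (Or.inl hz)
  rw [abs_lt] at h1
  rw [Complex.log_mul (by simp) hz0, Complex.log_neg_I]
  · ring
  · rw [Complex.arg_neg_I]
    constructor <;> linarith [Real.pi_pos]

/-- Since $\Gamma(n+r+\gamma)=(\gamma)_{n+r}\Gamma(\gamma)$, the termwise integrals produce exactly
the coefficients of `padeDenom`, in reversed order. -/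
theorem sum_Gamma_mul_cexp (hγ : ∀ p : ℕ, γ ≠ -(p : ℝ)) {z : ℂ} (hz : z ≠ 0) :
    ∑ r ∈ Finset.range (∑ i, m i + 1), ((nodePoly lam m).coeff r : ℂ) *
      (Real.Gamma ((n : ℝ) + r + γ) * Complex.exp (-((n : ℝ) + r + γ : ℝ) * Complex.log z)) =
    Real.Gamma ((n : ℝ) + (∑ i, m i : ℕ) + γ) *
      ((padeDenom γ lam n m).map Complex.ofRealHom).eval z *
      Complex.exp (-(((n : ℝ) + (∑ i, m i : ℕ) + γ : ℝ) : ℂ) * Complex.log z) := by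
  set d := ∑ i, m i with hd
  rw [eval_eq_sum_range' (Nat.lt_succ_of_le (natDegree_map_le.trans natDegree_padeDenom_le)),
    Finset.mul_sum, Finset.sum_mul, ← Finset.sum_range_reflect]
  refine Finset.sum_congr rfl fun p hp => ?_
  have hp' : p ≤ d := by simpa [Nat.lt_succ_iff] using hp
  rw [show d + 1 - 1 - p = d - p by omega, coeff_map, coeff_padeDenom hp', ← hd]
  have h1 : ∀ r : ℕ, Real.Gamma ((n : ℝ) + r + γ) = poch γ (n + r) * Real.Gamma γ := by
    intro r
    rw [← Gamma_add_natCast hγ]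
    congr 1
    push_cast
    ring
  have h2 : z ^ p = Complex.exp (p * Complex.log z) := by
    rw [Complex.exp_nat_mul, Complex.exp_log hz]
  have h3 : Complex.exp (-((n : ℝ) + (d - p : ℕ) + γ : ℝ) * Complex.log z) =
      Complex.exp (p * Complex.log z) *
        Complex.exp (-(((n : ℝ) + d + γ : ℝ) : ℂ) * Complex.log z) := by
    rw [← Complex.exp_add]
    congr 1
    push_cast [hp']
    ring
  have h4 : (poch γ (n + d) : ℂ) ≠ 0 := by exact_mod_cast poch_ne_zero hγ _
  rw [h1, h1, h2, h3]
  simp only [Complex.ofRealHom_eq_coe]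
  push_cast
  field_simp

theorem isLaplaceContinuation (hγ : ∀ p : ℕ, γ ≠ -(p : ℝ)) (hn : 0 < (n : ℝ) + γ) :
    IsLaplaceContinuation (weightU γ lam n m) (laplaceContinuation γ lam n m) := by
  constructor
  · intro z hz
    have h1 : -Complex.I * z ∈ Complex.slitPlane := by
      rw [Complex.mem_slitPlane_iff]
      rcases hz with hz | hz
      · exact Or.inr (by simpa using hz)
      · exact Or.inl (by simpa using hz)
    have h2 : DifferentiableAt ℂ (fun z => Complex.log (-Complex.I * z)) z :=
      (differentiableAt_id.const_mul _).clog h1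
    unfold laplaceContinuation
    refine DifferentiableAt.differentiableWithinAt ?_
    refine ((Polynomial.differentiable _).differentiableAt.const_mul _).mul ?_
    exact ((h2.add_const _).const_mul _).cexp
  · intro z hz
    have hz0 : z ≠ 0 := by
      rintro rfl
      simp at hz
    have h1 : Set.EqOn (fun t : ℝ => (weightU γ lam n m t : ℂ) * Complex.exp (-z * t))
        (fun t : ℝ => ∑ r ∈ Finset.range (∑ i, m i + 1), ((nodePoly lam m).coeff r : ℂ) *
          (((t ^ ((n : ℝ) + r + γ - 1) : ℝ) : ℂ) * Complex.exp (-z * t))) (Set.Ioi 0) := by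
      intro t ht
      simp only
      rw [weightU_eq_sum ht, Complex.ofReal_sum, Finset.sum_mul]
      refine Finset.sum_congr rfl fun r _ => ?_
      rw [Complex.ofReal_mul, mul_assoc]
    have hr : ∀ r : ℕ, 0 < (n : ℝ) + r + γ := fun r => by
      have : (0 : ℝ) ≤ r := Nat.cast_nonneg r
      linarith
    have h2 : ∀ r ∈ Finset.range (∑ i, m i + 1), MeasureTheory.Integrable
        (fun t : ℝ => ((nodePoly lam m).coeff r : ℂ) *
          (((t ^ ((n : ℝ) + r + γ - 1) : ℝ) : ℂ) * Complex.exp (-z * t)))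
        (MeasureTheory.volume.restrict (Set.Ioi 0)) := fun r _ =>
      (integrableOn_rpow_mul_cexp (hr r) hz).const_mul _
    refine ⟨(MeasureTheory.integrableOn_congr_fun h1 measurableSet_Ioi).2
      (MeasureTheory.integrable_finsetSum _ h2), ?_⟩
    rw [MeasureTheory.setIntegral_congr_fun measurableSet_Ioi h1,
      MeasureTheory.integral_finsetSum _ h2]
    simp only [MeasureTheory.integral_const_mul]
    rw [laplaceContinuation, log_neg_I_mul hz, ← sum_Gamma_mul_cexp hγ hz0]
    refine Finset.sum_congr rfl fun r _ => ?_
    rw [integral_rpow_mul_cexp (hr r) hz]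

theorem norm_laplaceContinuation {z : ℂ} (hz : ‖z‖ = 1) : ‖laplaceContinuation γ lam n m z‖ =
    |Real.Gamma ((n : ℝ) + (∑ i, m i : ℕ) + γ)| *
      ‖((padeDenom γ lam n m).map Complex.ofRealHom).eval z‖ := by
  have h1 : (-(((n : ℝ) + (∑ i, m i : ℕ) + γ : ℝ) : ℂ) *
      (Complex.log (-Complex.I * z) + Real.pi / 2 * Complex.I)).re = 0 := by
    rw [← Complex.ofReal_neg, Complex.re_ofReal_mul]
    simp [Complex.log_re, hz]
  rw [laplaceContinuation, norm_mul, norm_mul, Complex.norm_exp, h1, Real.exp_zero, mul_one,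
    Complex.norm_real, Real.norm_eq_abs]

/-! ### Comparison with linear approximations -/

/-- The sum is $\int_0^1s^{\gamma+n-1}B(\lambda_js)\,ds$. Every node that occurs is at least
$\lambda_j>\lambda_js$, so $(-1)^dB(\lambda_js)>0$ on $(0,1)$. -/
theorem sum_coeff_nodePoly_div_ne_zero (hn : 0 < γ + n) (hpos : ∀ j, 0 < lam j)
    (hmono : StrictMono lam) {j : Fin k} (hj : ∀ p < j, m p = 0) :
    ∑ r ∈ Finset.range (∑ i, m i + 1),
      (nodePoly lam m).coeff r * lam j ^ r / (γ + n + r) ≠ 0 := by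
  have h1 : ∀ r : ℕ, -1 < γ + n + r - 1 := fun r => by
    have : (0 : ℝ) ≤ r := Nat.cast_nonneg r
    linarith
  have hint : ∀ r : ℕ, IntervalIntegrable
      (fun s : ℝ => (nodePoly lam m).coeff r * lam j ^ r * s ^ (γ + n + r - 1))
      MeasureTheory.volume 0 1 := fun r =>
    (intervalIntegral.intervalIntegrable_rpow' (h1 r)).const_mul _
  have h2 : ∫ s in (0 : ℝ)..1, ∑ r ∈ Finset.range (∑ i, m i + 1),
      (nodePoly lam m).coeff r * lam j ^ r * s ^ (γ + n + r - 1) =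
      ∑ r ∈ Finset.range (∑ i, m i + 1),
        (nodePoly lam m).coeff r * lam j ^ r / (γ + n + r) := by
    rw [intervalIntegral.integral_finsetSum fun r _ => hint r]
    refine Finset.sum_congr rfl fun r _ => ?_
    have h3 : γ + n + r ≠ 0 := by linarith [h1 r]
    rw [intervalIntegral.integral_const_mul, integral_rpow (Or.inl (h1 r)), sub_add_cancel,
      Real.one_rpow, Real.zero_rpow h3, sub_zero, mul_one_div]
  rw [← h2]
  have h4 : 0 < ∫ s in (0 : ℝ)..1, (-1) ^ (∑ i, m i) * ∑ r ∈ Finset.range (∑ i, m i + 1),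
      (nodePoly lam m).coeff r * lam j ^ r * s ^ (γ + n + r - 1) := by
    refine intervalIntegral.intervalIntegral_pos_of_pos_on ?_ ?_ zero_lt_one
    · refine IntervalIntegrable.const_mul ?_ _
      have := IntervalIntegrable.sum (Finset.range (∑ i, m i + 1)) fun r _ => hint r
      simpa only [Finset.sum_fn] using this
    · intro s hs
      have h5 : ∑ r ∈ Finset.range (∑ i, m i + 1),
          (nodePoly lam m).coeff r * lam j ^ r * s ^ (γ + n + r - 1) =
          s ^ (γ + n - 1) * (nodePoly lam m).eval (lam j * s) := by
        rw [eval_eq_sum_range' (Nat.lt_succ_of_le (natDegree_nodePoly lam m).le), Finset.mul_sum]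
        refine Finset.sum_congr rfl fun r _ => ?_
        rw [show γ + n + r - 1 = γ + n - 1 + r by ring, Real.rpow_add_natCast hs.1.ne', mul_pow]
        ring
      have h6 : (-1) ^ (∑ i, m i) * (nodePoly lam m).eval (lam j * s) =
          ∏ p, (lam p - lam j * s) ^ m p := by
        rw [nodePoly, eval_prod, ← Finset.prod_pow_eq_pow_sum, ← Finset.prod_mul_distrib]
        refine Finset.prod_congr rfl fun p _ => ?_
        rw [eval_pow, ← mul_pow]
        simp
      rw [h5, mul_left_comm, h6]
      refine mul_pos (Real.rpow_pos_of_pos hs.1 _) (Finset.prod_pos fun p _ => ?_)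
      rcases lt_or_ge p j with hp | hp
      · simp [hj p hp]
      · refine pow_pos (sub_pos.2 ?_) _
        have h7 := hmono.monotone hp
        nlinarith [hs.2, hpos j]
  intro h0
  rw [intervalIntegral.integral_const_mul, h0, mul_zero] at h4
  exact lt_irrefl _ h4

theorem coeff_padeDenom_mul_ne_zero (hγ : ∀ p : ℕ, γ ≠ -(p : ℝ)) (hn : 0 < γ + n)
    (hpos : ∀ j, 0 < lam j) (hmono : StrictMono lam) {j : Fin k} (hj : ∀ p < j, m p = 0) :
    PowerSeries.coeff (n + ∑ i, m i + 1) (((padeDenom γ lam n m).map Complex.ofRealHom :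
      PowerSeries ℂ) * mittagLefflerSeries γ (lam j)) ≠ 0 := by
  rw [coeff_coe_mul_of_le (natDegree_map_le.trans natDegree_padeDenom_le) (by omega)]
  have h1 : ∀ r ∈ Finset.range (∑ i, m i + 1),
      ((padeDenom γ lam n m).map Complex.ofRealHom).coeff (∑ i, m i - r) *
        PowerSeries.coeff (n + ∑ i, m i + 1 - ∑ i, m i + r) (mittagLefflerSeries γ (lam j)) =
      ((lam j ^ (n + 1) / poch γ (n + ∑ i, m i) *
        ((nodePoly lam m).coeff r * lam j ^ r / (γ + n + r)) : ℝ) : ℂ) := by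
    intro r hr
    have hr' : r ≤ ∑ i, m i := by simpa [Nat.lt_succ_iff] using hr
    rw [coeff_map, coeff_padeDenom (Nat.sub_le _ _), Nat.sub_sub_self hr', mittagLefflerSeries,
      PowerSeries.coeff_mk, show n + ∑ i, m i + 1 - ∑ i, m i + r = n + r + 1 by omega, poch_succ,
      Complex.ofRealHom_eq_coe, ← Complex.ofReal_mul]
    congr 1
    have h2 := poch_ne_zero hγ (n + r)
    have h3 := poch_ne_zero hγ (n + ∑ i, m i)
    have h4 : γ + n + r ≠ 0 := by
      have : (0 : ℝ) ≤ r := Nat.cast_nonneg r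
      linarith
    have h5 : γ + (n + r : ℕ) = γ + n + r := by
      push_cast
      ring
    rw [h5]
    field_simp
    ring
  rw [Finset.sum_congr rfl h1, ← Complex.ofReal_sum, ← Finset.mul_sum]
  refine Complex.ofReal_ne_zero.2 (mul_ne_zero (div_ne_zero (pow_ne_zero _ (hpos j).ne')
    (poch_ne_zero hγ _)) (sum_coeff_nodePoly_div_ne_zero hn hpos hmono hj))

theorem ratQuot_eq_iff {P Q P' Q' : ℂ[X]} (hQ : Q ≠ 0) (hQ' : Q' ≠ 0) :
    ratQuot P Q = ratQuot P' Q' ↔ P * Q' = P' * Q := by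
  have h1 : algebraMap ℂ[X] (RatFunc ℂ) Q ≠ 0 := RatFunc.algebraMap_ne_zero hQ
  have h2 : algebraMap ℂ[X] (RatFunc ℂ) Q' ≠ 0 := RatFunc.algebraMap_ne_zero hQ'
  rw [ratQuot, ratQuot, div_eq_div_iff h1 h2, ← map_mul, ← map_mul]
  exact (RatFunc.algebraMap_injective ℂ).eq_iff

theorem IsNonlinearHermiteChebyshev.ne_zero {f : Fin k → ℝ → ℝ} {Q : ℂ[X]} {P : Fin k → ℂ[X]}
    (h : IsNonlinearHermiteChebyshev f n m Q P) : Q ≠ 0 := by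
  rintro rfl
  exact h.eval_ne_zero 0 (by norm_num) (by simp)

/-- If the fractions agreed, $Q$ times the nonlinear remainder would be the linear remainder, which
has no frequency of modulus at most $n+d$. -/
theorem IsNonlinearHermiteChebyshev.ratQuot_ne (hγ : ∀ p : ℕ, γ ≠ -(p : ℝ))
    {Qh Q : ℂ[X]} {Ph P : Fin k → ℂ[X]}
    (h : IsNonlinearHermiteChebyshev (fun j => chebF γ (lam j)) n m Qh Ph) {j : Fin k}
    (hlam : lam j ≠ 0) (hmj : m j ≠ 0) (hmn : m j ≤ n)
    (hne : ∀ a : ℕ → ℂ, (∀ l < n + ∑ i, m i + 1, a l = 0) →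
        (∀ x ∈ Set.Icc (-1 : ℝ) 1, HasSum (fun l => a l * (chebT l x : ℂ))
          ((chebF γ (lam j) x : ℂ) - (Ph j).eval (x : ℂ) / Qh.eval (x : ℂ))) →
        a (n + ∑ i, m i + 1) ≠ 0)
    (h' : IsLinearHermiteChebyshev (fun j => chebF γ (lam j)) n m Q P) :
    ratQuot (Ph j) Qh ≠ ratQuot (P j) Q := by
  intro heq
  rw [ratQuot_eq_iff h.ne_zero h'.ne_zero] at heq
  obtain ⟨a, ha0, ha⟩ := h.remainder j
  obtain ⟨b, hb0, hb⟩ := h'.remainder j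
  have haN := hne a ha0 ha
  have hIcc : ∀ θ : ℝ, Real.cos θ ∈ Set.Icc (-1 : ℝ) 1 := fun θ =>
    ⟨Real.neg_one_le_cos θ, Real.cos_le_one θ⟩
  have ha1 := summable_norm_of_hasSum_chebT (ha 1 (by norm_num))
  have hb1 := summable_norm_of_hasSum_chebT (hb 1 (by norm_num))
  have ha' := fun θ : ℝ => ha _ (hIcc θ)
  have hb' := fun θ : ℝ => hb _ (hIcc θ)
  set N := n + ∑ i, m i + 1 with hN
  have hQN : Q.natDegree < N := by
    have := h'.natDegree_denom
    omega
  have hprod : ∀ θ : ℝ, Q.eval (Real.cos θ : ℂ) * ((chebF γ (lam j) (Real.cos θ) : ℂ) -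
      (Ph j).eval (Real.cos θ : ℂ) / Qh.eval (Real.cos θ : ℂ)) =
      Q.eval (Real.cos θ : ℂ) * (chebF γ (lam j) (Real.cos θ) : ℂ) -
        (P j).eval (Real.cos θ : ℂ) := by
    intro θ
    have h1 := h.eval_ne_zero _ (hIcc θ)
    have h2 := congrArg (fun A => A.eval (Real.cos θ : ℂ)) heq
    simp only [eval_mul] at h2
    field_simp
    linear_combination -h2
  -- A constant $Q$ does not shift the remainder. It is excluded since $\deg P_j\le n+d-m_j<n+d$,
  -- while $F_j$ has a nonzero Chebyshev coefficient at $n+d$.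
  rcases Nat.eq_zero_or_pos Q.natDegree with hd | hd
  · obtain ⟨c, rfl⟩ := natDegree_eq_zero.1 hd
    have hc : c ≠ 0 := by
      rintro rfl
      exact h'.ne_zero (by simp)
    have hE := summable_norm_coeff_mittagLefflerSeries hγ (lam j)
    have hF := hasSum_chebF hγ (lam j)
    have hFc := continuous_of_hasSum_chebT hE hF
    have hsum : m j ≤ ∑ i, m i := Finset.single_le_sum (fun i _ => Nat.zero_le _)
      (Finset.mem_univ j)
    have h1 := circleCoeff_eq_zero hb1 hb' hb0 (l := ((n + ∑ i, m i : ℕ) : ℤ)) (by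
      rw [abs_of_nonneg (by omega)]
      omega)
    have h2 : ∀ θ : ℝ, (C c).eval (Real.cos θ : ℂ) * (chebF γ (lam j) (Real.cos θ) : ℂ) -
        (P j).eval (Real.cos θ : ℂ) = c * (chebF γ (lam j) (Real.cos θ) : ℂ) +
          -1 * (P j).eval (Real.cos θ : ℂ) := by
      intro θ
      rw [eval_C]
      ring
    simp only [h2] at h1
    have h3 := h'.natDegree_num j
    rw [circleCoeff_add (by fun_prop) (by fun_prop), circleCoeff_const_mul, circleCoeff_const_mul,
      circleCoeff_eval_cos_eq_zero _ (by omega),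
      circleCoeff_eq_pi_mul hE hF (by omega), mul_zero, add_zero] at h1
    have h4 : PowerSeries.coeff (n + ∑ i, m i) (mittagLefflerSeries γ (lam j)) ≠ 0 := by
      rw [mittagLefflerSeries, PowerSeries.coeff_mk]
      exact Complex.ofReal_ne_zero.2 (div_ne_zero (pow_ne_zero _ hlam) (poch_ne_zero hγ _))
    exact mul_ne_zero hc (mul_ne_zero (Complex.ofReal_ne_zero.2 Real.pi_ne_zero) h4) h1
  -- For $\deg Q>0$ the first coefficient of the nonlinear remainder reappears, multiplied by a
  -- nonzero constant, at the forbidden index $n+d+1-\deg Q$.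
  · have hτ := continuous_of_hasSum_chebT ha1 ha'
    have h1 := circleCoeff_eval_cos_mul_of_gap hτ (N := N)
      (fun l hl => circleCoeff_eq_zero ha1 ha' ha0 hl) Q (by omega)
    simp only [hprod] at h1
    rw [circleCoeff_eq_zero hb1 hb' hb0, circleCoeff_eq_pi_mul ha1 ha' (by omega)] at h1
    · refine mul_ne_zero (leadingCoeff_ne_zero.2 h'.ne_zero) (div_ne_zero (mul_ne_zero
        (Complex.ofReal_ne_zero.2 Real.pi_ne_zero) haN) (pow_ne_zero _ two_ne_zero)) h1.symm
    · rw [abs_lt]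
      omega

end

/-! ### Conjugation on the unit circle and the final assembly -/

theorem eval_map_exp_neg (q : ℝ[X]) (θ : ℝ) :
    (q.map Complex.ofRealHom).eval (Complex.exp (-(θ * Complex.I))) =
      starRingEnd ℂ ((q.map Complex.ofRealHom).eval (Complex.exp (θ * Complex.I))) := by
  have h : Complex.exp (-(θ * Complex.I)) = starRingEnd ℂ (Complex.exp (θ * Complex.I)) := by
    rw [← Complex.exp_conj]
    simp
  rw [h, eval_map, eval_map, hom_eval₂]
  congr 1
  ext x
  simp

theorem exp_arccos_mul_I {x : ℝ} (hx : x ∈ Set.Icc (-1 : ℝ) 1) :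
    Complex.exp (Real.arccos x * Complex.I) =
      (x : ℂ) + Complex.I * (Real.sqrt (1 - x ^ 2) : ℝ) := by
  rw [Complex.exp_mul_I, ← Complex.ofReal_cos, ← Complex.ofReal_sin, Real.cos_arccos hx.1 hx.2,
    Real.sin_arccos, mul_comm]

end

theorem theorem6 {k : ℕ} (γ : ℝ) (hγ : ∀ p : ℕ, γ ≠ -(p : ℝ))
    (lam : Fin k → ℝ) (hlam : Function.Injective lam) (hlam0 : ∀ j, lam j ≠ 0) :
    ∃ n₀ : ℕ, ∀ n : ℕ, n₀ ≤ n → ∀ m : Fin k → ℕ, m ≠ 0 → (∀ j, m j ≤ n) →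
      -- `Qm` is the Hermite–Padé denominator of the Mittag-Leffler system, normalized at `0`
      ∃ Qm : Polynomial ℂ, Qm.eval 0 = 1 ∧
        (∃ P, IsHermitePade (fun j => mittagLefflerSeries γ (lam j)) n m Qm P) ∧
        (∀ Q' P', IsHermitePade (fun j => mittagLefflerSeries γ (lam j)) n m Q' P' →
          ∃ c : ℂ, Q' = Polynomial.C c * Qm) ∧
      ∃ Φ : ℂ → ℂ, IsLaplaceContinuation (weightU γ lam n m) Φ ∧
        -- existence of nonlinear approximations
        (∃ Qh Ph, IsNonlinearHermiteChebyshev (fun j => chebF γ (lam j)) n m Qh Ph) ∧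
        ∀ Qh Ph, IsNonlinearHermiteChebyshev (fun j => chebF γ (lam j)) n m Qh Ph →
          -- the denominator, up to normalization
          (∃ c : ℂ, c ≠ 0 ∧ ∀ x ∈ Set.Icc (-1 : ℝ) 1,
            Qh.eval (x : ℂ) = c * (Qm.eval (Complex.exp (Complex.I * Real.arccos x)) *
              starRingEnd ℂ (Qm.eval (Complex.exp (Complex.I * Real.arccos x)))) ∧
            Qh.eval (x : ℂ) = c * ((1 / Real.Gamma ((n : ℝ) + (∑ i, m i : ℕ) + γ) ^ 2 *
              ‖Φ ((x : ℂ) + Complex.I * (Real.sqrt (1 - x ^ 2) : ℝ))‖ ^ 2 : ℝ) : ℂ)) ∧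
          -- one of the nonlinear approximations is not a linear one
          ((∀ j, 0 < lam j) → StrictMono lam →
            ∃ j, ∀ Q P, IsLinearHermiteChebyshev (fun j => chebF γ (lam j)) n m Q P →
              ratQuot (Ph j) Qh ≠ ratQuot (P j) Q) := by
  obtain ⟨n₁, hn₁⟩ := exists_forall_eval_padeDenom_ne_zero hγ lam
  obtain ⟨n₂, hn₂⟩ := exists_nat_gt (-γ)
  -- `n₁` keeps $Q_m$ free of zeros in the closed disc; `n₂` gives $\gamma+n>0$, needed for both
  -- integrals.
  refine ⟨max n₁ n₂, fun n hn m hm0 hmn => ?_⟩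
  have hnγ : 0 < γ + n := by
    have : (n₂ : ℝ) ≤ n := by exact_mod_cast (le_max_right _ _).trans hn
    linarith
  obtain ⟨P, hP⟩ := isHermitePade_padeDenom (n := n) (m := m) hγ hlam hlam0 hmn
  set Qm := (padeDenom γ lam n m).map Complex.ofRealHom with hQm
  have hQm0 : Qm.eval 0 = 1 := by
    rw [hQm, ← map_zero Complex.ofRealHom, Polynomial.eval_map_apply, eval_zero_padeDenom hγ,
      map_one]
  have huniq : ∀ Q' P', IsHermitePade (fun j => mittagLefflerSeries γ (lam j)) n m Q' P' →
      ∃ c : ℂ, Q' = Polynomial.C c * Qm := fun Q' P' h => h.eq_C_mul_padeDenom hγ hlam hlam0 hmn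
  refine ⟨Qm, hQm0, ⟨P, hP⟩, huniq, laplaceContinuation γ lam n m,
    isLaplaceContinuation hγ (by linarith), ⟨_, _, hP.isNonlinearHermiteChebyshev hγ hmn
      (hn₁ n ((le_max_left _ _).trans hn) m)⟩, fun Qh Ph h => ?_⟩
  obtain ⟨q, hq0, ⟨P', hq⟩, ⟨c, hc, hQh⟩, hcoeff⟩ := h.exists_invRootsPoly hγ hmn
  obtain rfl : q = Qm := by
    obtain ⟨c', hc'⟩ := huniq q P' hq
    rw [hc', Polynomial.eval_mul, Polynomial.eval_C, hQm0, mul_one] at hq0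
    rw [hc', hq0, map_one, one_mul]
  refine ⟨⟨c, hc, fun x hx => ?_⟩, fun hpos hmono => ?_⟩
  · have h1 := hQh (Real.arccos x)
    rw [Real.cos_arccos hx.1 hx.2, hQm, eval_map_exp_neg] at h1
    rw [mul_comm Complex.I (Real.arccos x : ℂ)]
    refine ⟨h1, ?_⟩
    rw [h1, Complex.mul_conj, Complex.normSq_eq_norm_sq, ← exp_arccos_mul_I hx,
      norm_laplaceContinuation (Complex.norm_exp_ofReal_mul_I _), mul_pow, sq_abs]
    have hΓ : Real.Gamma ((n : ℝ) + (∑ i, m i : ℕ) + γ) ≠ 0 := by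
      refine (Real.Gamma_pos_of_pos ?_).ne'
      have : (0 : ℝ) ≤ (∑ i, m i : ℕ) := Nat.cast_nonneg _
      linarith
    congr 2
    field_simp
  -- With increasing $\lambda_p$, the smallest such index belongs to the smallest node that occurs,
  -- so $B(\lambda_js)$ does not change sign on $(0,1)$.
  · obtain ⟨j, hj, hmin⟩ := WellFounded.has_min (wellFounded_lt (α := Fin k)) {j | m j ≠ 0}
      (Function.ne_iff.1 hm0)
    refine ⟨j, fun Q P hlin => h.ratQuot_ne hγ (hlam0 j) hj (hmn j) (fun a ha0 ha => ?_) hlin⟩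
    rw [← hcoeff j a ha0 ha]
    exact coeff_padeDenom_mul_ne_zero hγ hnγ hpos hmono fun p hp => by
      by_contra hne
      exact hmin p hne hp
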